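/- **Pieri rule for $GL_n(\mathbb F_q)$.** Let $\mathbb F_q$ be a finite field and write $GL_n=GL_n(\mathbb F_q)$; all representations are complex. For a Young diagram $D=(d_1\ge d_2\ge\dots)$ with $n$ boxes let $P_D\subset GL_n$ be the stabilizer of the flag $0\subset\mathbb F_q^{d_1}\subset\mathbb F_q^{d_1+d_2}\subset\dots\subset\mathbb F_q^{n}$ of coordinate subspaces, and let $I_D=\mathrm{Ind}_{P_D}^{GL_n}(\mathbf 1)$ be the space of complex functions on $GL_n/P_D$ with the left translation action. For diagrams with $n$ boxes, say that $E$ strictly dominates $D$ if $E\ne D$ and $d_1+\dots+d_i\le e_1+\dots+e_i$ for all $i$. Then $I_D$ has exactly one irreducible subrepresentation that does not occur in $I_E$ for any $E$ strictly dominating $D$; it is denoted $\rho_D$ (the spherical principal series representation attached to $D$). Let $0\le k\le n$ and let $D$ be a Young diagram with $k$ boxes. Let $P_{k,n-k}\subset GL_n$ be the stabilizer of the span of the first $k$ coordinate vectors of $\mathbb F_q^n$, with its natural surjection onto $GL_k\times GL_{n-k}$ (diagonal blocks), let $\mathbf 1_{n-k}$ be the trivial representation of $GL_{n-k}$, and let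 $$I_{\rho_D}=\mathrm{Ind}_{P_{k,n-k}}^{GL_n}(\rho_D\otimes\mathbf 1_{n-k}),$$ where $\rho_D\otimes\mathbf 1_{n-k}$ is pulled back to $P_{k,n-k}$. Then $I_{\rho_D}$ is multiplicity-free, and $$I_{\rho_D}\;\cong\;\bigoplus_{E}\rho_E ,$$ where $E$ runs over the Young diagrams with $n$ boxes such that $E\supset D$ and $E-D$ is a horizontal $(n-k)$-strip, i.e. each column of $E$ is at most one box longer than the corresponding column of $D$. Moreover, for a Young diagram $E$ with $n$ boxes, $\rho_E$ occurs in $I_{\rho_D}$ if and only if $E$ satisfies these conditions. -/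

import Mathlib

open scoped MatrixGroups TensorProduct

noncomputable section

namespace GLPieri

/-! ### Young diagrams -/

/-- The set of Young diagrams with exactly `n` boxes. -/
abbrev Diagram (n : ℕ) : Type := {D : YoungDiagram // D.card = n}

/-- The number of boxes in the first `i` rows of `D`, that is `d₁ + ⋯ + dᵢ`. -/
def rowSum (D : YoungDiagram) (i : ℕ) : ℕ := ∑ l ∈ Finset.range i, D.rowLen l

/-- `E` strictly dominates `D` (for diagrams with the same number of boxes): `D ≠ E` and
`d₁ + ⋯ + dᵢ ≤ e₁ + ⋯ + eᵢ` for all `i`. -/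
def StrictlyDominates {n : ℕ} (E D : Diagram n) : Prop :=
  D ≠ E ∧ ∀ i : ℕ, rowSum D.1 i ≤ rowSum E.1 i

/-- `E ⊇ D` and the skew diagram `E - D` is a horizontal strip: each column of `E` is at most one
box longer than the corresponding column of `D`. The strip has `n - k` boxes when `D` and `E` have
`k` and `n` boxes. -/
def IsHorizontalStrip (D E : YoungDiagram) : Prop :=
  D ≤ E ∧ ∀ j : ℕ, E.colLen j ≤ D.colLen j + 1

/-! ### Representations -/

section Reps

variable {G V W : Type*} [Group G] [AddCommGroup V] [Module ℂ V] [AddCommGroup W] [Module ℂ W]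

/-- The space of complex valued functions on a `G`-set `X`, with the left action
`(g f)(x) = f (g⁻¹ x)`. -/
def functionRep (G X : Type*) [Group G] [MulAction G X] : Representation ℂ G (X → ℂ) where
  toFun g :=
    { toFun := fun f x => f (g⁻¹ • x)
      map_add' := fun _ _ => rfl
      map_smul' := fun _ _ => rfl }
  map_one' := by ext; simp
  map_mul' g h := by
    apply LinearMap.ext
    intro f
    funext x
    simp [mul_smul]

/-- `τ` is isomorphic to a subrepresentation of `ρ`. -/
def OccursIn (τ : Representation ℂ G V) (ρ : Representation ℂ G W) : Prop :=
  ∃ f : τ.IntertwiningMap ρ, Function.Injective f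

/-- Every irreducible subrepresentation `U` of `ρ` has multiplicity `dim Hom(U, ρ) = 1`. -/
def IsMultiplicityFree (ρ : Representation ℂ G V) : Prop :=
  ∀ U : Subrepresentation ρ, U.toRepresentation.IsIrreducible →
    Module.finrank ℂ (U.toRepresentation.IntertwiningMap ρ) = 1

end Reps

/-- The external tensor product `ρ ⊗ σ` of representations of `G` and `H`, as a representation of
`G × H`. -/
def outerTensor {G H V W : Type*} [Group G] [Group H] [AddCommGroup V] [Module ℂ V]
    [AddCommGroup W] [Module ℂ W] (ρ : Representation ℂ G V) (σ : Representation ℂ H W) :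
    Representation ℂ (G × H) (V ⊗[ℂ] W) :=
  Representation.tprod (ρ.comp (MonoidHom.fst G H)) (σ.comp (MonoidHom.snd G H))

/-! ### Parabolic subgroups -/

section Parabolic

variable (F : Type*) [Field F]

/-- The subspace of `Fⁿ` spanned by the first `s` coordinate vectors. -/
def coordSubspace (n s : ℕ) : Submodule F (Fin n → F) where
  carrier := {v | ∀ j : Fin n, s ≤ (j : ℕ) → v j = 0}
  zero_mem' := fun _ _ => rfl
  add_mem' := by
    intro a b ha hb j hj
    simp [ha j hj, hb j hj]
  smul_mem' := by
    intro c a ha j hj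
    simp [ha j hj]

/-- The subgroup of `GLₙ(F)` of all `g` with `g V = V`. -/
def stabilizer {n : ℕ} (V : Submodule F (Fin n → F)) : Subgroup (GL (Fin n) F) where
  carrier := {g | V.map (g : Matrix (Fin n) (Fin n) F).mulVecLin = V}
  one_mem' := by simp
  mul_mem' := by
    intro a b ha hb
    simp only [Set.mem_ofPred_eq] at ha hb ⊢
    rw [Units.val_mul, Matrix.mulVecLin_mul, Submodule.map_comp, hb, ha]
  inv_mem' := by
    intro a ha
    simp only [Set.mem_ofPred_eq] at ha ⊢
    conv_lhs => rw [← ha]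
    rw [← Submodule.map_comp, ← Matrix.mulVecLin_mul, ← Units.val_mul]
    simp

/-- The standard parabolic subgroup `P_D` of `GLₙ(F)`: the stabilizer of the flag
`0 ⊆ F^{d₁} ⊆ F^{d₁ + d₂} ⊆ ⋯ ⊆ Fⁿ`. -/
def parabolic {n : ℕ} (D : Diagram n) : Subgroup (GL (Fin n) F) :=
  ⨅ i : ℕ, stabilizer F (coordSubspace F n (rowSum D.1 i))

/-- The standard maximal parabolic subgroup `P_{k,m}` of `GL_{k+m}(F)`: the stabilizer of the
subspace spanned by the first `k` coordinate vectors. -/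
def maxParabolic (k m : ℕ) : Subgroup (GL (Fin (k + m)) F) :=
  stabilizer F (coordSubspace F (k + m) k)

variable {F}

lemma maxParabolic_lower_left {k m : ℕ} (g : maxParabolic F k m) (i : Fin m) (j : Fin k) :
    (g.1 : Matrix (Fin (k + m)) (Fin (k + m)) F) (Fin.natAdd k i) (Fin.castAdd m j) = 0 := by
  have hg : (coordSubspace F (k + m) k).map
      (g.1 : Matrix (Fin (k + m)) (Fin (k + m)) F).mulVecLin = coordSubspace F (k + m) k := g.2
  have hv : (Pi.single (Fin.castAdd m j) 1 : Fin (k + m) → F) ∈ coordSubspace F (k + m) k := by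
    intro l hl
    apply Pi.single_eq_of_ne
    intro h
    have hj := j.2
    rw [h, Fin.val_castAdd] at hl
    omega
  have h := Submodule.mem_map_of_mem (f := (g.1 : Matrix (Fin (k + m)) (Fin (k + m)) F).mulVecLin) hv
  rw [hg] at h
  have h2 := h (Fin.natAdd k i) (by simp)
  simpa using h2

/-- The upper left `k × k` block of a matrix in `P_{k,m}`. -/
def upperBlock (k m : ℕ) : maxParabolic F k m →* GL (Fin k) F :=
  MonoidHom.toHomUnits
    { toFun := fun g =>
        (g.1 : Matrix (Fin (k + m)) (Fin (k + m)) F).submatrix (Fin.castAdd m) (Fin.castAdd m)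
      map_one' := by
        ext i j
        simp [Matrix.one_apply]
      map_mul' := by
        intro g h
        ext i j
        simp [Matrix.mul_apply, Fin.sum_univ_add, maxParabolic_lower_left] }

/-- The lower right `m × m` block of a matrix in `P_{k,m}`. -/
def lowerBlock (k m : ℕ) : maxParabolic F k m →* GL (Fin m) F :=
  MonoidHom.toHomUnits
    { toFun := fun g =>
        (g.1 : Matrix (Fin (k + m)) (Fin (k + m)) F).submatrix (Fin.natAdd k) (Fin.natAdd k)
      map_one' := by
        ext i j
        simp [Matrix.one_apply]
      map_mul' := by
        intro g h
        ext i j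
        simp [Matrix.mul_apply, Fin.sum_univ_add, maxParabolic_lower_left] }

/-- The natural surjection `P_{k,m} → GL_k × GL_m`. -/
def leviProjection (k m : ℕ) : maxParabolic F k m →* GL (Fin k) F × GL (Fin m) F :=
  (upperBlock k m).prod (lowerBlock k m)

section Induction

variable {k m : ℕ} {V W : Type*} [AddCommGroup V] [Module ℂ V] [AddCommGroup W] [Module ℂ W]

/-- The representation `ρ ⊗ σ` of `GL_k(F) × GL_m(F)`, pulled back to `P_{k,m}`. -/
def inflation (ρ : Representation ℂ (GL (Fin k) F) V) (σ : Representation ℂ (GL (Fin m) F) W) :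
    Representation ℂ (maxParabolic F k m) (V ⊗[ℂ] W) :=
  (outerTensor ρ σ).comp (leviProjection k m)

/-- The space of the representation of `GL_{k+m}(F)` induced from the pull back to `P_{k,m}` of
`ρ ⊗ σ`. -/
abbrev ParabolicIndSpace (ρ : Representation ℂ (GL (Fin k) F) V)
    (σ : Representation ℂ (GL (Fin m) F) W) : Type _ :=
  Representation.IndV (k := ℂ) (A := V ⊗[ℂ] W) (maxParabolic F k m).subtype (inflation ρ σ)

/-- The representation of `GL_{k+m}(F)` induced from the pull back to `P_{k,m}` of `ρ ⊗ σ`. -/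
def parabolicInd (ρ : Representation ℂ (GL (Fin k) F) V)
    (σ : Representation ℂ (GL (Fin m) F) W) :
    Representation ℂ (GL (Fin (k + m)) F) (ParabolicIndSpace ρ σ) :=
  Representation.ind (k := ℂ) (A := V ⊗[ℂ] W) (maxParabolic F k m).subtype (inflation ρ σ)

end Induction

end Parabolic

/-! ### Spherical principal series and the representation to be decomposed -/

section Series

variable (F : Type*) [Field F]

/-- The representation `I_D`, induced from the trivial representation of `P_D`: the functions on
`GLₙ(F) / P_D`. -/
abbrev flagRep {n : ℕ} (D : Diagram n) :
    Representation ℂ (GL (Fin n) F) (GL (Fin n) F ⧸ parabolic F D → ℂ) :=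
  functionRep (GL (Fin n) F) (GL (Fin n) F ⧸ parabolic F D)

/-- `U` is an irreducible subrepresentation of `I_D` which does not occur in `I_E` for any `E`
that strictly dominates `D`. -/
def IsNewIn {n : ℕ} (D : Diagram n) (U : Subrepresentation (flagRep F D)) : Prop :=
  U.toRepresentation.IsIrreducible ∧
    ∀ E : Diagram n, StrictlyDominates E D → ¬ OccursIn U.toRepresentation (flagRep F E)

/-- The sum of all the irreducible subrepresentations of `I_D` which do not occur in any `I_E` with
`E` strictly dominating `D`. If there is exactly one such subrepresentation (which is the same as
this sum being irreducible), the sum is that subrepresentation. -/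
def spsSub {n : ℕ} (D : Diagram n) : Subrepresentation (flagRep F D) where
  toSubmodule := ⨆ U : {U : Subrepresentation (flagRep F D) // IsNewIn F D U}, U.1.toSubmodule
  apply_mem_toSubmodule := by
    intro g v hv
    have key : (⨆ U : {U : Subrepresentation (flagRep F D) // IsNewIn F D U}, U.1.toSubmodule) ≤
        (⨆ U : {U : Subrepresentation (flagRep F D) // IsNewIn F D U}, U.1.toSubmodule).comap
          (flagRep F D g) :=
      iSup_le fun U x hx =>
        (le_iSup (fun U : {U : Subrepresentation (flagRep F D) // IsNewIn F D U} =>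
          U.1.toSubmodule) U) (U.1.apply_mem_toSubmodule g hx)
    exact key hv

/-- The spherical principal series representation `ρ_D` of `GLₙ(F)` attached to `D`. -/
abbrev sps {n : ℕ} (D : Diagram n) :
    Representation ℂ (GL (Fin n) F) (spsSub F D).toSubmodule :=
  (spsSub F D).toRepresentation

/-- The space of the representation of `GL_{k+m}(F)` attached to `D`. -/
abbrev PieriSpace {k : ℕ} (m : ℕ) (D : Diagram k) : Type _ :=
  ParabolicIndSpace (sps F D) (Representation.trivial ℂ (GL (Fin m) F) ℂ)

/-- The representation of `GL_{k+m}(F)` induced from the pull back to `P_{k,m}` of `ρ_D ⊗ 1_m`. -/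
abbrev pieriRep {k : ℕ} (m : ℕ) (D : Diagram k) :
    Representation ℂ (GL (Fin (k + m)) F) (PieriSpace F m D) :=
  parabolicInd (sps F D) (Representation.trivial ℂ (GL (Fin m) F) ℂ)

end Series

end GLPieri

end

/-!
# The Pieri rule for `GLₙ(F)`

All the representations in question are compared through their characters and the pairing
`⟨χ, ψ⟩ = |G|⁻¹ ∑ χ(g) ψ(g⁻¹)`, which counts intertwining maps.

For a composition `c` of `n` let `I_c` be the space of functions on the flags with block sizes `c`.
The dimension of `Hom(I_c, I_d)` is the number of orbits of `GLₙ(F)` on pairs of flags of types `c`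
and `d`. By the Bruhat decomposition, in the form that any two flags admit a common adapted basis,
such an orbit is the same as a matrix of natural numbers with row sums `c` and column sums `d`
(`card_orbits_eq_ncard`). On the other hand let `K_{X,c}` be the Kostka number, that is, the number
of ways to build the diagram `X` by adding successively horizontal strips of sizes `c₁, c₂, …`.
Removing a horizontal strip and adding another one can be exchanged at the cost of an additional
parameter (`card_common_superdiagrams`), which gives
`∑_X K_{X,c} K_{X,d} = #{matrices with margins c, d}` (`sum_kostka_mul_kostka`), hence
`⟨I_c, I_d⟩ = ∑_X K_{X,c} K_{X,d}`.

The square matrix of the `K_{E,D}` is unitriangular for the dominance order, so it has an integral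
inverse, and the corresponding combinations `χ_E` of the characters of the `I_D` are orthonormal
virtual characters with `⟨χ_E, I_D⟩ = K_{E,D}`. Being of norm one and having positive pairing with
`I_E`, `χ_E` is the character of an irreducible subrepresentation of `I_E`
(`exists_sub_character_eq`), and Young's rule `I_c = ∑_X K_{X,c} χ_X` (`flagCharacter_eq_sum`)
together with triangularity shows that it is the only one which does not occur in any `I_D` with `D`
strictly dominating `E`. Therefore `χ_E` is the character of `ρ_E` (`sps_spec`).

Finally, parabolic induction from `GL_k × GL_m` of a virtual combination of the `I_E`, tensored with
the trivial representation, appends a block of size `m` to every flag type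
(`pairing_parabolicInd`, `compositionParabolic_appendBlock`). Since Kostka numbers are defined by
adding horizontal strips, Young's rule shows that the combination which gives `χ_D` becomes the sum
of the `χ_E` over all `E` for which `E - D` is a horizontal `m`-strip
(`sum_inverseKostka_flagCharacter_appendBlock`).
-/

noncomputable section

namespace GLPieri

/-! ### The pairing of class functions -/

section Pairing

variable {G : Type*} [Group G] [Finite G]

/-- The bilinear pairing `|G|⁻¹ ∑ f(g) h(g⁻¹)` of complex functions on a finite group. -/
def pairing (f h : G → ℂ) : ℂ :=
  (Nat.card G : ℂ)⁻¹ * ∑ᶠ g, f g * h g⁻¹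

omit [Finite G] in
lemma pairing_eq_sum [Fintype G] (f h : G → ℂ) :
    pairing f h = (Nat.card G : ℂ)⁻¹ * ∑ g, f g * h g⁻¹ := by
  rw [pairing, finsum_eq_sum_of_fintype]

lemma pairing_comm (f h : G → ℂ) : pairing f h = pairing h f := by
  have := Fintype.ofFinite G
  rw [pairing_eq_sum, pairing_eq_sum, ← Equiv.sum_comp (Equiv.inv G)]
  simp [mul_comm]

lemma pairing_add_left (f₁ f₂ h : G → ℂ) :
    pairing (f₁ + f₂) h = pairing f₁ h + pairing f₂ h := by
  have := Fintype.ofFinite G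
  simp only [pairing_eq_sum, Pi.add_apply, add_mul, Finset.sum_add_distrib, mul_add]

lemma pairing_sub_left (f₁ f₂ h : G → ℂ) :
    pairing (f₁ - f₂) h = pairing f₁ h - pairing f₂ h := by
  have := Fintype.ofFinite G
  simp only [pairing_eq_sum, Pi.sub_apply, sub_mul, Finset.sum_sub_distrib, mul_sub]

lemma pairing_zsmul_left (a : ℤ) (f h : G → ℂ) :
    pairing (a • f) h = a * pairing f h := by
  have := Fintype.ofFinite G
  simp only [pairing_eq_sum, Pi.smul_apply, Finset.mul_sum]
  exact Finset.sum_congr rfl fun _ _ => by rw [zsmul_eq_mul]; ring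

lemma pairing_sum_left {ι : Type*} (s : Finset ι) (f : ι → G → ℂ) (h : G → ℂ) :
    pairing (∑ i ∈ s, f i) h = ∑ i ∈ s, pairing (f i) h := by
  classical
  induction s using Finset.induction_on with
  | empty => simp [pairing]
  | insert i s hi ih => rw [Finset.sum_insert hi, Finset.sum_insert hi, pairing_add_left, ih]

lemma pairing_sub_right (f h₁ h₂ : G → ℂ) :
    pairing f (h₁ - h₂) = pairing f h₁ - pairing f h₂ := by
  simp only [pairing_comm f, pairing_sub_left]

lemma pairing_zsmul_right (a : ℤ) (f h : G → ℂ) :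
    pairing f (a • h) = a * pairing f h := by
  simp only [pairing_comm f, pairing_zsmul_left]

lemma pairing_sum_right {ι : Type*} (s : Finset ι) (f : G → ℂ) (h : ι → G → ℂ) :
    pairing f (∑ i ∈ s, h i) = ∑ i ∈ s, pairing f (h i) := by
  simp only [pairing_comm f, pairing_sum_left]

variable (G) in
omit [Finite G] in
/-- The functions with `f(g⁻¹)` the complex conjugate of `f(g)`; all characters have this property
and the pairing is positive definite on these functions. -/
def hermitianFunctions : AddSubgroup (G → ℂ) where
  carrier := {f | ∀ g, f g⁻¹ = star (f g)}
  zero_mem' := by simp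
  add_mem' := by
    intro a b ha hb g
    simp only [Set.mem_ofPred_eq] at ha hb
    simp [ha, hb]
  neg_mem' := by
    intro a ha g
    simp only [Set.mem_ofPred_eq] at ha
    simp [ha]

omit [Finite G] in
lemma pairing_self [Fintype G] {f : G → ℂ} (hf : f ∈ hermitianFunctions G) :
    pairing f f = (((Nat.card G : ℝ)⁻¹ * ∑ g, ‖f g‖ ^ 2 : ℝ) : ℂ) := by
  have hf' : ∀ g, f g⁻¹ = star (f g) := hf
  rw [pairing_eq_sum]
  push_cast
  congr 1
  refine Finset.sum_congr rfl fun g _ => ?_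
  rw [hf' g]
  exact Complex.mul_conj' (f g)

lemma eq_zero_of_pairing_self {f : G → ℂ} (hf : f ∈ hermitianFunctions G)
    (h : pairing f f = 0) : f = 0 := by
  have := Fintype.ofFinite G
  rw [pairing_self hf] at h
  have h2 : ∑ g, ‖f g‖ ^ 2 = 0 := by
    rcases mul_eq_zero.1 (Complex.ofReal_eq_zero.1 h) with h | h
    · exact absurd h (by simp)
    · exact h
  funext g
  have := (Finset.sum_eq_zero_iff_of_nonneg (fun g _ => by positivity)).1 h2 g (Finset.mem_univ g)
  simpa using this

lemma pairing_self_nonneg {f : G → ℂ} (hf : f ∈ hermitianFunctions G) {z : ℤ}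
    (h : pairing f f = z) : 0 ≤ z := by
  have := Fintype.ofFinite G
  rw [pairing_self hf] at h
  have h1 : (Nat.card G : ℝ)⁻¹ * ∑ g, ‖f g‖ ^ 2 = (z : ℝ) := by exact_mod_cast h
  have h2 : (0 : ℝ) ≤ (z : ℝ) := h1 ▸ by positivity
  exact_mod_cast h2

lemma eq_of_pairing {f h : G → ℂ} (hf : f ∈ hermitianFunctions G) (hh : h ∈ hermitianFunctions G)
    (H : pairing (f - h) (f - h) = 0) : f = h :=
  sub_eq_zero.1 (eq_zero_of_pairing_self (sub_mem hf hh) H)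

end Pairing

/-! ### Characters of finite groups -/

section Characters

open Representation

variable {G V W : Type*} [Group G] [Finite G] [AddCommGroup V] [Module ℂ V]
  [FiniteDimensional ℂ V] [AddCommGroup W] [Module ℂ W] [FiniteDimensional ℂ W]

open scoped ComplexOrder in
open Matrix in
/-- An invariant Hermitian form, obtained by averaging, makes `ρ(g)` conjugate to a matrix whose
inverse is its conjugate transpose. -/
lemma character_mem_hermitianFunctions (ρ : Representation ℂ G V) :
    ρ.character ∈ hermitianFunctions G := by
  intro g
  have := Fintype.ofFinite G
  classical
  let b := Module.finBasis ℂ V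
  let A : G → Matrix (Fin (Module.finrank ℂ V)) (Fin (Module.finrank ℂ V)) ℂ :=
    fun g => LinearMap.toMatrix b b (ρ g)
  have hA : ∀ g h, A (g * h) = A g * A h := fun g h => by
    simp only [A, map_mul]
    exact LinearMap.toMatrix_mul b _ _
  have hA1 : A 1 = 1 := by simp [A]
  let H := ∑ h, (A h)ᴴ * A h
  have hH : H.PosDef := by
    have : H = (∑ h ∈ Finset.univ.erase 1, (A h)ᴴ * A h) + 1 := by
      simp only [H]
      rw [← Finset.sum_erase_add _ _ (Finset.mem_univ (1 : G)), hA1]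
      simp
    rw [this]
    exact Matrix.PosDef.posSemidef_add
      (Matrix.posSemidef_sum _ fun h _ => Matrix.posSemidef_conjTranspose_mul_self (A h))
      Matrix.PosDef.one
  have hinv : (A g)ᴴ * H * A g = H := by
    simp only [H, Finset.mul_sum, Finset.sum_mul]
    conv_rhs => rw [← Equiv.sum_comp (Equiv.mulRight g)]
    refine Finset.sum_congr rfl fun h _ => ?_
    change _ = (A (h * g))ᴴ * A (h * g)
    rw [hA, Matrix.conjTranspose_mul]
    simp only [Matrix.mul_assoc]
  have hdet : IsUnit H.det := hH.det_pos.ne'.isUnit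
  have hgg : A g * A g⁻¹ = 1 := by rw [← hA, mul_inv_cancel, hA1]
  have h1 : (A g)ᴴ * H = H * A g⁻¹ := by
    calc (A g)ᴴ * H = (A g)ᴴ * H * (A g * A g⁻¹) := by rw [hgg, mul_one]
      _ = (A g)ᴴ * H * A g * A g⁻¹ := by simp only [Matrix.mul_assoc]
      _ = H * A g⁻¹ := by rw [hinv]
  have h2 : A g⁻¹ = H⁻¹ * ((A g)ᴴ * H) := by
    rw [h1, ← Matrix.mul_assoc, Matrix.nonsing_inv_mul _ hdet, one_mul]
  have htr : ∀ g, ρ.character g = (A g).trace := fun g =>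
    LinearMap.trace_eq_matrix_trace ℂ b (ρ g)
  rw [htr, htr, h2, Matrix.trace_mul_comm, Matrix.mul_assoc, Matrix.mul_nonsing_inv _ hdet,
    mul_one, Matrix.trace_conjTranspose]

lemma pairing_character (ρ : Representation ℂ G V) (σ : Representation ℂ G W) :
    pairing σ.character ρ.character = Module.finrank ℂ (ρ.IntertwiningMap σ) := by
  have := Fintype.ofFinite G
  have : Invertible (Nat.card G : ℂ) := invertibleOfNonzero (by simp)
  rw [pairing_eq_sum, card_inv_mul_sum_char_mul_char_eq_finrank]

omit [Finite G] in
lemma character_eq_add {ρ : Representation ℂ G V} {U U₁ U₂ : Subrepresentation ρ}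
    (hd : U₁ ⊓ U₂ = ⊥) (hs : U₁ ⊔ U₂ = U) :
    U.toRepresentation.character =
      U₁.toRepresentation.character + U₂.toRepresentation.character := by
  have h1 : U₁.toSubmodule ≤ U.toSubmodule := (hs ▸ le_sup_left : U₁ ≤ U)
  have h2 : U₂.toSubmodule ≤ U.toSubmodule := (hs ▸ le_sup_right : U₂ ≤ U)
  have hd' : Disjoint U₁.toSubmodule U₂.toSubmodule := by
    rw [disjoint_iff, ← Subrepresentation.toSubmodule_inf, hd]; rfl
  have hs' : U₁.toSubmodule ⊔ U₂.toSubmodule = U.toSubmodule := by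
    rw [← Subrepresentation.toSubmodule_sup, hs]
  let e : (U₁.toSubmodule × U₂.toSubmodule) ≃ₗ[ℂ] U.toSubmodule :=
    LinearEquiv.ofBijective
      ((Submodule.inclusion h1).coprod (Submodule.inclusion h2)) (by
      constructor
      · rw [← LinearMap.ker_eq_bot, LinearMap.ker_eq_bot']
        rintro ⟨x, y⟩ hxy
        have hxy' : (x : V) + y = 0 := congrArg Subtype.val hxy
        have hx : (x : V) = 0 := by
          have : (x : V) ∈ U₁.toSubmodule ⊓ U₂.toSubmodule :=
            ⟨x.2, by rw [eq_neg_of_add_eq_zero_left hxy']; exact neg_mem y.2⟩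
          rwa [hd'.eq_bot] at this
        have hy : (y : V) = 0 := by simpa [hx] using hxy'
        ext <;> assumption
      · rintro ⟨z, hz⟩
        rw [← hs'] at hz
        obtain ⟨x, hx, y, hy, rfl⟩ := Submodule.mem_sup.1 hz
        exact ⟨(⟨x, hx⟩, ⟨y, hy⟩), rfl⟩)
  have he : (U₁.toRepresentation.prod U₂.toRepresentation).Equiv U.toRepresentation :=
    Representation.Equiv.mk e (fun g => by
      apply LinearMap.ext
      rintro ⟨x, y⟩
      apply Subtype.ext
      exact (map_add (ρ g) (x : V) (y : V)).symm)
  rw [← char_iso he]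
  funext g
  exact LinearMap.trace_prodMap' _ _

omit [Finite G] [FiniteDimensional ℂ V] in
lemma character_top (ρ : Representation ℂ G V) :
    (⊤ : Subrepresentation ρ).toRepresentation.character = ρ.character := by
  refine char_iso (Representation.Equiv.mk (Submodule.topEquiv (R := ℂ) (M := V)) fun g => ?_)
  rfl

omit [Finite G] [FiniteDimensional ℂ V] in
/-- The inclusion of a subrepresentation. -/
def inclusionMap {ρ : Representation ℂ G V} (U : Subrepresentation ρ) :
    U.toRepresentation.IntertwiningMap ρ :=
  ⟨U.toSubmodule.subtype, fun _ => rfl⟩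

omit [Finite G] [FiniteDimensional ℂ V] in
lemma inclusionMap_injective {ρ : Representation ℂ G V} (U : Subrepresentation ρ) :
    Function.Injective (inclusionMap U) := Subtype.val_injective

omit [Finite G] [FiniteDimensional ℂ V] in
lemma isIrreducible_of_minimal {ρ : Representation ℂ G V} {U : Subrepresentation ρ}
    (hU : U ≠ ⊥) (h : ∀ U' < U, U' = ⊥) : U.toRepresentation.IsIrreducible := by
  have hnt : Nontrivial (Subrepresentation U.toRepresentation) := by
    refine ⟨⊥, ⊤, fun hbt => hU ?_⟩
    apply Subrepresentation.toSubmodule_injective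
    refine eq_bot_iff.2 (?_ : U.toSubmodule ≤ ⊥)
    intro x hx
    have : (⟨x, hx⟩ : U.toSubmodule) ∈ (⊤ : Subrepresentation U.toRepresentation) := trivial
    rw [← hbt] at this
    exact congrArg Subtype.val (show (⟨x, hx⟩ : U.toSubmodule) = 0 from this)
  refine { eq_bot_or_eq_top := fun W => ?_ }
  let W' : Subrepresentation ρ := ⟨W.toSubmodule.map U.toSubmodule.subtype, by
    rintro g _ ⟨w, hw, rfl⟩
    exact ⟨_, W.apply_mem_toSubmodule g hw, rfl⟩⟩
  have hle : W' ≤ U := by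
    rintro _ ⟨w, -, rfl⟩
    exact w.2
  rcases hle.eq_or_lt with heq | hlt
  · right
    rw [eq_top_iff]
    intro x _
    have : (x : V) ∈ W' := (congrArg (fun Z : Subrepresentation ρ => (x : V) ∈ Z) heq).mpr x.2
    obtain ⟨w, hw, hwx⟩ := this
    have hwx' : w = x := Subtype.ext hwx
    rw [← hwx']
    exact hw
  · left
    rw [eq_bot_iff]
    intro x hx
    have hx' : (x : V) ∈ W' := ⟨x, hx, rfl⟩
    rw [h W' hlt] at hx'
    exact Subtype.ext hx'

/-- An integral virtual character of norm one which pairs positively with `V` is the character of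
an irreducible constituent of `V`: a minimal subrepresentation pairing positively with it is
irreducible, and two unit vectors with positive integral inner product are equal. -/
lemma exists_irreducible_character_eq {ρ : Representation ℂ G V} {f : G → ℂ}
    (hf : f ∈ hermitianFunctions G) (hff : pairing f f = 1)
    (hint : ∀ U : Subrepresentation ρ, ∃ z : ℤ, pairing f U.toRepresentation.character = z)
    {z : ℤ} (hz : 0 < z) (hρ : pairing f ρ.character = z) :
    ∃ U : Subrepresentation ρ, U.toRepresentation.IsIrreducible ∧
      U.toRepresentation.character = f := by
  choose m hm using hint
  let S : Set (Subrepresentation ρ) := {U | 0 < m U}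
  have hS : S.Nonempty := ⟨⊤, by
    have := hm ⊤
    rw [character_top, hρ] at this
    have h' : z = m ⊤ := by exact_mod_cast this
    exact (h' ▸ hz : 0 < m ⊤)⟩
  obtain ⟨U, hUS, hmin⟩ := exists_minimalFor_of_wellFoundedLT (· ∈ S)
    (fun U : Subrepresentation ρ => Module.finrank ℂ U.toSubmodule) hS
  have hUm : 0 < m U := hUS
  have hadd : ∀ {X U₁ U₂ : Subrepresentation ρ}, U₁ ⊓ U₂ = ⊥ → U₁ ⊔ U₂ = X →
      m X = m U₁ + m U₂ := by
    intro X U₁ U₂ h1 h2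
    have := character_eq_add h1 h2
    have h3 := hm X
    rw [this, pairing_comm, pairing_add_left, pairing_comm _ f, pairing_comm _ f, hm, hm] at h3
    exact_mod_cast h3.symm
  have hbot : m ⊥ = 0 := by
    have := hadd (X := ⊥) (U₁ := ⊥) (U₂ := ⊥) (by simp) (by simp)
    omega
  have hlt : ∀ U' < U, ¬ 0 < m U' := fun U' hU' hpos => by
    have h1 := hmin (j := U') hpos
      (Submodule.finrank_mono (show U'.toSubmodule ≤ U.toSubmodule from hU'.le))
    have h2 : Module.finrank ℂ U'.toSubmodule < Module.finrank ℂ U.toSubmodule :=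
      Submodule.finrank_lt_finrank_of_lt (lt_of_le_of_ne hU'.le
        fun h => hU'.ne (Subrepresentation.toSubmodule_injective h))
    exact absurd h1 (not_le.2 h2)
  have hirr : U.toRepresentation.IsIrreducible := by
    refine isIrreducible_of_minimal (fun h => by rw [h, hbot] at hUm; exact lt_irrefl _ hUm) ?_
    intro U' hU'
    by_contra hne
    obtain ⟨C, hC⟩ := exists_isCompl U'
    have h1 : U' ⊓ (C ⊓ U) = ⊥ := by
      rw [← inf_assoc, hC.inf_eq_bot, bot_inf_eq]
    have h2 : U' ⊔ (C ⊓ U) = U := by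
      apply Subrepresentation.toSubmodule_injective
      have h3 : U'.toSubmodule ⊔ C.toSubmodule = ⊤ := by
        rw [← Subrepresentation.toSubmodule_sup, hC.sup_eq_top]; rfl
      rw [Subrepresentation.toSubmodule_sup, Subrepresentation.toSubmodule_inf,
        ← sup_inf_assoc_of_le _ (show U'.toSubmodule ≤ U.toSubmodule from hU'.le), h3, top_inf_eq]
    have h3 : C ⊓ U < U := by
      refine lt_of_le_of_ne inf_le_right fun h => hne ?_
      rw [h, inf_eq_left.2 hU'.le] at h1
      exact h1
    have := hadd h1 h2
    have := hlt _ hU'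
    have := hlt _ h3
    omega
  refine ⟨U, hirr, ?_⟩
  have hUU : pairing U.toRepresentation.character U.toRepresentation.character = 1 := by
    rw [pairing_character, IsIrreducible.finrank_intertwiningMap_self, Nat.cast_one]
  have hexp : pairing (f - U.toRepresentation.character) (f - U.toRepresentation.character)
      = ((2 - 2 * m U : ℤ) : ℂ) := by
    rw [pairing_sub_left, pairing_sub_right, pairing_sub_right, hff, hUU,
      pairing_comm _ f, hm]
    push_cast; ring
  have hherm := character_mem_hermitianFunctions U.toRepresentation
  have hnn := pairing_self_nonneg (sub_mem hf hherm) hexp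
  have h1 : m U = 1 := by omega
  refine (eq_of_pairing hf hherm ?_).symm
  rw [hexp, h1]
  norm_num

/-- Two irreducible representations with a nonzero intertwining map are isomorphic. -/
lemma nonempty_equiv_of_pairing_ne_zero {ρ : Representation ℂ G V} {σ : Representation ℂ G W}
    (hρ : ρ.IsIrreducible) (hσ : σ.IsIrreducible)
    (h : pairing σ.character ρ.character ≠ 0) : Nonempty (ρ.Equiv σ) := by
  by_contra hne
  rw [not_nonempty_iff] at hne
  apply h
  rw [pairing_character, Module.finrank_zero_of_subsingleton, Nat.cast_zero]

omit [Finite G] in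
lemma occursIn_iff_finrank_pos {ρ : Representation ℂ G V} {σ : Representation ℂ G W}
    (hρ : ρ.IsIrreducible) :
    OccursIn ρ σ ↔ 0 < Module.finrank ℂ (ρ.IntertwiningMap σ) := by
  constructor
  · rintro ⟨f, hf⟩
    refine Module.finrank_pos_iff_exists_ne_zero.2 ⟨f, fun h0 => ?_⟩
    obtain ⟨a, b, hab⟩ := hρ.toNontrivial
    apply hab
    have hz : ∀ v : V, v = 0 := fun v => hf (by rw [h0]; simp)
    apply Subrepresentation.toSubmodule_injective
    ext v
    rw [hz v]
    simp
  · intro h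
    obtain ⟨f, hf⟩ := Module.finrank_pos_iff_exists_ne_zero.1 h
    exact ⟨f, (IsIrreducible.injective_or_eq_zero f).resolve_right hf⟩

omit [Finite G] [FiniteDimensional ℂ V] in
lemma occursIn_inclusion {ρ : Representation ℂ G V} (U : Subrepresentation ρ) :
    OccursIn U.toRepresentation ρ := ⟨inclusionMap U, inclusionMap_injective U⟩

section Decomposition

variable {ι : Type*} [Fintype ι] [DecidableEq ι] {M : ι → Type*} [∀ i, AddCommGroup (M i)]
  [∀ i, Module ℂ (M i)] [∀ i, FiniteDimensional ℂ (M i)]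
  {ρ : Representation ℂ G V} {σ : ∀ i, Representation ℂ G (M i)}

lemma isMultiplicityFree_of_character_eq_sum
    (hirr : ∀ i, (σ i).IsIrreducible)
    (horth : ∀ i j, pairing (σ i).character (σ j).character = if i = j then 1 else 0)
    (hχ : ρ.character = ∑ i, (σ i).character) : IsMultiplicityFree ρ := by
  intro U hU
  have h1 := (occursIn_iff_finrank_pos hU).1 (occursIn_inclusion U)
  have h2 := pairing_character U.toRepresentation ρ
  rw [hχ, pairing_sum_left] at h2
  obtain ⟨i, hi⟩ : ∃ i, pairing (σ i).character U.toRepresentation.character ≠ 0 := by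
    by_contra hall
    push Not at hall
    rw [Finset.sum_eq_zero fun i _ => hall i] at h2
    have : Module.finrank ℂ (U.toRepresentation.IntertwiningMap ρ) = 0 := by exact_mod_cast h2.symm
    omega
  obtain ⟨e⟩ := nonempty_equiv_of_pairing_ne_zero hU (hirr i) hi
  rw [char_iso e] at h2
  simp only [horth, Finset.sum_ite_eq', Finset.mem_univ, if_true] at h2
  exact_mod_cast h2.symm

/-- A representation whose character is a sum of pairwise distinct irreducible characters is the
direct sum of the corresponding irreducible representations. -/
lemma nonempty_equiv_directSum
    (hirr : ∀ i, (σ i).IsIrreducible)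
    (horth : ∀ i j, pairing (σ i).character (σ j).character = if i = j then 1 else 0)
    (hχ : ρ.character = ∑ i, (σ i).character) :
    Nonempty (ρ.Equiv (Representation.directSum σ)) := by
  have hone : ∀ i, 0 < Module.finrank ℂ ((σ i).IntertwiningMap ρ) := fun i => by
    have h := pairing_character (σ i) ρ
    rw [hχ, pairing_sum_left] at h
    simp only [horth, Finset.sum_ite_eq', Finset.mem_univ, if_true] at h
    have : Module.finrank ℂ ((σ i).IntertwiningMap ρ) = 1 := by exact_mod_cast h.symm
    omega
  choose f hf using fun i => (occursIn_iff_finrank_pos (hirr i)).2 (hone i)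
  have hzero : ∀ i j, i ≠ j → ∀ h : (σ i).IntertwiningMap (σ j), h = 0 := fun i j hij h => by
    have h1 := pairing_character (σ i) (σ j)
    rw [horth, if_neg (Ne.symm hij)] at h1
    have h2 : Module.finrank ℂ ((σ i).IntertwiningMap (σ j)) = 0 := by exact_mod_cast h1.symm
    exact (Module.finrank_zero_iff (R := ℂ)).1 h2 |>.elim h 0
  -- Maschke: every embedding has an equivariant left inverse.
  have hleft : ∀ i, ∃ p : ρ.IntertwiningMap (σ i), ∀ v, p (f i v) = v := fun i => by
    obtain ⟨q, hq⟩ := MonoidAlgebra.exists_leftInverse_of_injective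
      (IntertwiningMap.equivLinearMapAsModule _ _ (f i)) (LinearMap.ker_eq_bot.2 (hf i))
    refine ⟨(IntertwiningMap.equivLinearMapAsModule _ _).symm q, fun v => ?_⟩
    exact LinearMap.congr_fun hq v
  choose p hp using hleft
  let T : (DirectSum ι M) →ₗ[ℂ] V := DirectSum.toModule ℂ ι V fun i => (f i).toLinearMap
  have hT : ∀ i (x : DirectSum ι M), p i (T x) = x i := fun i x => by
    induction x using DirectSum.induction_on with
    | zero => simp
    | of j v =>
      have : T (DirectSum.of M j v) = f j v := by
        simp only [T]
        exact DirectSum.toModule_lof ℂ j v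
      rw [this]
      by_cases hij : j = i
      · subst hij
        rw [hp, DirectSum.of_eq_same]
      · rw [DirectSum.of_eq_of_ne _ _ _ (Ne.symm hij)]
        have := hzero j i hij ((p i).comp (f j))
        exact DFunLike.congr_fun this v
    | add x y hx hy => rw [map_add, map_add, hx, hy]; rfl
  have hinj : Function.Injective T := fun x y hxy => by
    refine DFinsupp.ext fun i => ?_
    have := hT i x
    rw [hxy] at this
    exact this.symm.trans (hT i y)
  have hdim : Module.finrank ℂ (DirectSum ι M) = Module.finrank ℂ V := by
    have h1 := congrFun hχ 1
    simp only [Finset.sum_apply, char_one] at h1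
    rw [Module.finrank_directSum]
    exact_mod_cast h1.symm
  let e : DirectSum ι M ≃ₗ[ℂ] V := LinearEquiv.ofInjectiveOfFinrankEq T hinj hdim
  have he : ∀ x, e x = T x := fun x => rfl
  refine ⟨(Representation.Equiv.mk (ρ := Representation.directSum σ) (σ := ρ) e fun g => ?_).symm⟩
  apply LinearMap.ext
  intro x
  change T (Representation.directSum σ g x) = ρ g (T x)
  induction x using DirectSum.induction_on with
  | zero => simp
  | of j v =>
    have h1 : Representation.directSum σ g (DirectSum.of M j v) = DirectSum.of M j (σ j g v) :=
      DirectSum.lmap_lof (fun i => σ i g) j v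
    have h2 : ∀ w, T (DirectSum.of M j w) = f j w := fun w => DirectSum.toModule_lof ℂ j w
    rw [h1, h2, h2]
    exact IntertwiningMap.isIntertwining _ _ (f j) g v
  | add x y hx hy => rw [map_add, map_add, map_add, map_add, hx, hy]

end Decomposition

end Characters

/-! ### Permutation characters and induction -/

section Induced

open Representation

lemma functionRep_character {G X : Type*} [Group G] [MulAction G X] [Finite X] (g : G) :
    (functionRep G X).character g = Nat.card {x : X // g • x = x} := by
  classical
  have := Fintype.ofFinite X
  rw [Representation.character, LinearMap.trace_eq_matrix_trace ℂ (Pi.basisFun ℂ X), Matrix.trace]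
  have h : ∀ x, (LinearMap.toMatrix (Pi.basisFun ℂ X) (Pi.basisFun ℂ X)
      (functionRep G X g)).diag x = if g • x = x then 1 else 0 := fun x => by
    rw [Matrix.diag_apply, LinearMap.toMatrix_apply]
    simp only [Pi.basisFun_apply, Pi.basisFun_repr]
    change (Pi.single x (1 : ℂ) : X → ℂ) (g⁻¹ • x) = _
    simp only [Pi.single_apply, inv_smul_eq_iff]
    exact if_congr eq_comm rfl rfl
  simp only [h, Finset.sum_boole, Nat.card_eq_fintype_card, Fintype.card_subtype]

variable {P K : Type*} [Group P] [Finite P] [Group K] [Finite K]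

/-- Pairing a class function with the pull back of a transitive permutation character averages it
over a point stabilizer. -/
lemma pairing_functionRep_comp (u : P →* K) (hu : Function.Surjective u) (H : Subgroup K)
    {ψ : P → ℂ} (hψ : ∀ p q, ψ (q * p * q⁻¹) = ψ p) :
    pairing (fun p => (functionRep K (K ⧸ H)).character (u p)) ψ =
      (Nat.card (H.comap u) : ℂ)⁻¹ * ∑ᶠ h : H.comap u, ψ h := by
  classical
  have := Fintype.ofFinite P
  have := Fintype.ofFinite (K ⧸ H)
  have := Fintype.ofFinite (H.comap u)
  rw [pairing_comm, pairing_eq_sum, finsum_eq_sum_of_fintype]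
  set S := ∑ h : H.comap u, ψ h with hS
  have hpt : ∀ x : K ⧸ H, (∑ p, if u p⁻¹ • x = x then ψ p else 0) = S := fun x => by
    obtain ⟨k, rfl⟩ := QuotientGroup.mk_surjective x
    obtain ⟨q, rfl⟩ := hu k
    rw [← Equiv.sum_comp (MulAut.conj q).toEquiv]
    have h1 : ∀ p, (u ((MulAut.conj q).toEquiv p)⁻¹ • ((u q : K) : K ⧸ H) = ((u q : K) : K ⧸ H)) ↔
        p ∈ H.comap u := fun p => by
      change (u (q * p * q⁻¹)⁻¹ • ((u q : K) : K ⧸ H) = ((u q : K) : K ⧸ H)) ↔ _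
      rw [map_inv, inv_smul_eq_iff, MulAction.Quotient.smul_coe, QuotientGroup.eq]
      simp [mul_assoc]
    have h2 : ∀ p, ψ ((MulAut.conj q).toEquiv p) = ψ p := fun p => hψ p q
    simp only [h1, h2]
    rw [hS, ← Finset.sum_filter]
    exact Finset.sum_subtype _ (by simp) _
  have h1 : ∀ p, ψ p * (functionRep K (K ⧸ H)).character (u p⁻¹) =
      ∑ x : K ⧸ H, if u p⁻¹ • x = x then ψ p else 0 := fun p => by
    rw [functionRep_character, ← Finset.sum_filter, Finset.sum_const, nsmul_eq_mul, mul_comm,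
      Nat.card_eq_fintype_card, Fintype.card_subtype]
  simp only [h1]
  rw [Finset.sum_comm, Finset.sum_congr rfl fun x _ => hpt x, Finset.sum_const, nsmul_eq_mul,
    Finset.card_univ, ← mul_assoc]
  congr 1
  have h2 : Nat.card (H.comap u) * Fintype.card (K ⧸ H) = Nat.card P := by
    rw [← Subgroup.card_mul_index (H.comap u), Subgroup.index_comap_of_surjective H hu,
      Subgroup.index, Nat.card_eq_fintype_card (α := K ⧸ H)]
  have h3 : (Nat.card (H.comap u) : ℂ) ≠ 0 := Nat.cast_ne_zero.2 Nat.card_pos.ne'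
  rw [← h2]
  have h4 : (Fintype.card (K ⧸ H) : ℂ) ≠ 0 := by simp
  push_cast
  field_simp

/-- The inner product of two permutation characters is the number of orbits on pairs. -/
lemma pairing_functionRep_functionRep {G X Y : Type*} [Group G] [Finite G] [MulAction G X]
    [MulAction G Y] [Finite X] [Finite Y] :
    pairing (functionRep G X).character (functionRep G Y).character =
      Nat.card (MulAction.orbitRel.Quotient G (X × Y)) := by
  classical
  have := Fintype.ofFinite G
  have := Fintype.ofFinite X
  have := Fintype.ofFinite Y
  have hB := MulAction.sum_card_fixedBy_eq_card_orbits_mul_card_group G (X × Y)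
  have h1 : ∀ g : G, (functionRep G X).character g * (functionRep G Y).character g⁻¹ =
      (Fintype.card (MulAction.fixedBy (X × Y) g) : ℂ) := fun g => by
    rw [functionRep_character, functionRep_character, ← Nat.cast_mul, ← Nat.card_prod,
      ← Nat.card_eq_fintype_card]
    congr 1
    refine Nat.card_congr
      { toFun := fun p => ⟨(p.1.1, p.2.1), Prod.ext p.1.2 (inv_smul_eq_iff.1 p.2.2).symm⟩
        invFun := fun p => (⟨p.1.1, congrArg Prod.fst p.2⟩,
          ⟨p.1.2, inv_smul_eq_iff.2 (congrArg Prod.snd p.2).symm⟩)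
        left_inv := fun _ => rfl
        right_inv := fun _ => rfl }
  rw [pairing_eq_sum]
  simp only [h1]
  rw [← Nat.cast_sum, hB, Nat.card_eq_fintype_card, Nat.card_eq_fintype_card]
  have : (Fintype.card G : ℂ) ≠ 0 := by simp
  push_cast
  field_simp

variable {H G : Type*} [Group H] [Group G] (φ : H →* G) {A B : Type*} [AddCommGroup A] [Module ℂ A]
  [AddCommGroup B] [Module ℂ B] (ρ : Representation ℂ H A) (σ : Representation ℂ G B)

/-- Frobenius reciprocity. -/
def indHomEquiv : (ind φ ρ).IntertwiningMap σ ≃ₗ[ℂ] ρ.IntertwiningMap (σ.comp φ) where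
  toFun f := ⟨f.toLinearMap ∘ₗ IndV.mk φ ρ 1, fun g => by
    ext x
    have := (IntertwiningMap.isIntertwining _ _ f (φ g) (IndV.mk φ ρ 1 x)).symm
    simp_all [← Coinvariants.mk_inv_tmul]⟩
  map_add' _ _ := rfl
  map_smul' _ _ := rfl
  invFun f := ⟨Coinvariants.lift _
    (TensorProduct.lift <| (Finsupp.lift _ _ _ fun h => σ h⁻¹ ∘ₗ f.toLinearMap) ∘ₗ
      (MonoidAlgebra.coeffLinearEquiv ℂ).toLinearMap)
    fun g => by
      ext h x
      have := IntertwiningMap.isIntertwining _ _ f g x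
      simp_all [mul_inv_rev], fun g => by ext; simp⟩
  left_inv f := by
    apply IntertwiningMap.ext
    ext h a
    simpa using (IntertwiningMap.isIntertwining _ _ f h⁻¹ (IndV.mk φ ρ 1 a)).symm
  right_inv f := by
    apply IntertwiningMap.ext
    ext
    simp

end Induced

/-! ### Parabolic induction from the trivial representation of the second factor -/

section ParabolicInduction

open Representation

variable {F : Type*} [Field F]

lemma mem_stabilizer_iff {n : ℕ} {V : Submodule F (Fin n → F)} {g : GL (Fin n) F} :
    g ∈ stabilizer F V ↔ ∀ v ∈ V, (g : Matrix (Fin n) (Fin n) F).mulVec v ∈ V := by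
  constructor
  · intro h v hv
    have h' : V.map (g : Matrix (Fin n) (Fin n) F).mulVecLin = V := h
    rw [← h']
    exact ⟨v, hv, rfl⟩
  · intro h
    have hle : V.map (g : Matrix (Fin n) (Fin n) F).mulVecLin ≤ V := by
      rintro _ ⟨v, hv, rfl⟩
      exact h v hv
    refine Submodule.eq_of_le_of_finrank_eq hle
      (Submodule.equivMapOfInjective _ ?_ V).finrank_eq.symm
    exact Matrix.mulVec_injective_of_isUnit g.isUnit

lemma upperBlock_apply {k m : ℕ} (g : maxParabolic F k m) (i j : Fin k) :
    (upperBlock k m g : Matrix (Fin k) (Fin k) F) i j =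
      (g.1 : Matrix (Fin (k + m)) (Fin (k + m)) F) (Fin.castAdd m i) (Fin.castAdd m j) := rfl

lemma upperBlock_surjective (k m : ℕ) : Function.Surjective (upperBlock (F := F) k m) := by
  intro g
  let M : GL (Fin (k + m)) F :=
    Units.map (Matrix.reindexAlgEquiv F F (finSumFinEquiv (m := k) (n := m))).toMonoidHom
      ⟨Matrix.fromBlocks g.1 0 0 1, Matrix.fromBlocks g⁻¹.1 0 0 1, by
        simp [Matrix.fromBlocks_multiply], by simp [Matrix.fromBlocks_multiply]⟩
  have hM : ∀ a b,
      (M : Matrix (Fin (k + m)) (Fin (k + m)) F) (finSumFinEquiv a) (finSumFinEquiv b) =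
        Matrix.fromBlocks g.1 0 0 1 a b := fun a b => by
    simp [M]
  have hmem : M ∈ maxParabolic F k m := by
    refine mem_stabilizer_iff.2 fun v hv j hj => ?_
    obtain ⟨j, rfl⟩ := finSumFinEquiv.surjective j
    rcases j with j | j
    · simp at hj
      have := j.2
      omega
    · rw [Matrix.mulVec, dotProduct, ← Equiv.sum_comp finSumFinEquiv, Fintype.sum_sum_type]
      have h1 : ∀ x : Fin m, v (finSumFinEquiv (Sum.inr x)) = 0 := fun x => hv _ (by simp)
      simp only [hM, h1, mul_zero, Finset.sum_const_zero, add_zero, Matrix.fromBlocks_apply₂₁,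
        Matrix.zero_apply, zero_mul]
  refine ⟨⟨M, hmem⟩, ?_⟩
  apply Units.ext
  ext i j
  rw [upperBlock_apply]
  exact hM (Sum.inl i) (Sum.inl j)

variable [Finite F]

variable {k m : ℕ} {V B : Type*} [AddCommGroup V] [Module ℂ V] [FiniteDimensional ℂ V]
  [AddCommGroup B] [Module ℂ B] [FiniteDimensional ℂ B]

/-- The character of the representation parabolically induced from `ρ ⊗ 1` depends linearly on the
character of `ρ`, and the permutation character on `GL_k / H` induces to the one on `GL_{k+m} / H'`,
with `H'` the preimage of `H` in the parabolic subgroup. By Frobenius reciprocity, both sides paired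
with `σ` are averages of the character of `σ` over the subgroups `H'`. -/
lemma pairing_parabolicInd {ι : Type*} [Fintype ι] (a : ι → ℤ) (H : ι → Subgroup (GL (Fin k) F))
    (H' : ι → Subgroup (GL (Fin (k + m)) F))
    (hH : ∀ i, H' i = ((H i).comap (upperBlock k m)).map (maxParabolic F k m).subtype)
    (ρ : Representation ℂ (GL (Fin k) F) V)
    (hρ : ρ.character = ∑ i, a i • (functionRep (GL (Fin k) F) (GL (Fin k) F ⧸ H i)).character)
    (σ : Representation ℂ (GL (Fin (k + m)) F) B) :
    pairing σ.character
        (parabolicInd ρ (Representation.trivial ℂ (GL (Fin m) F) ℂ)).character =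
      pairing σ.character
        (∑ i, a i • (functionRep (GL (Fin (k + m)) F) (GL (Fin (k + m)) F ⧸ H' i)).character) := by
  rw [pairing_character, parabolicInd, (indHomEquiv _ _ σ).finrank_eq, ← pairing_character]
  have h1 : (inflation ρ (Representation.trivial ℂ (GL (Fin m) F) ℂ)).character =
      ∑ i, a i • fun p => (functionRep (GL (Fin k) F) (GL (Fin k) F ⧸ H i)).character
        (upperBlock k m p) := by
    funext p
    have h2 : (inflation ρ (Representation.trivial ℂ (GL (Fin m) F) ℂ)).character p =
        ρ.character (upperBlock k m p) := by
      have h3 : inflation ρ (Representation.trivial ℂ (GL (Fin m) F) ℂ) p =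
        TensorProduct.map (ρ (upperBlock k m p)) LinearMap.id := rfl
      rw [Representation.character, h3, LinearMap.trace_tensorProduct']
      simp [Representation.character]
    rw [h2, hρ]
    simp
  rw [h1, pairing_sum_right, pairing_sum_right]
  refine Finset.sum_congr rfl fun i _ => ?_
  rw [pairing_zsmul_right, pairing_zsmul_right]
  congr 1
  rw [pairing_comm, pairing_functionRep_comp _ (upperBlock_surjective k m), pairing_comm]
  · have h4 := pairing_functionRep_comp (MonoidHom.id (GL (Fin (k + m)) F)) Function.surjective_id
      (H' i) (ψ := σ.character) fun p q => char_conj σ p q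
    refine Eq.trans ?_ h4.symm
    have hmem : ∀ p : (H' i).comap (MonoidHom.id (GL (Fin (k + m)) F)),
        ∃ q ∈ (H i).comap (upperBlock k m), q.1 = p.1 := fun p =>
      (hH i).le p.2
    let e : (H i).comap (upperBlock k m) ≃ (H' i).comap (MonoidHom.id (GL (Fin (k + m)) F)) :=
      { toFun := fun p => ⟨p.1.1, (hH i).symm ▸ ⟨p.1, p.2, rfl⟩⟩
        invFun := fun p => ⟨⟨p.1, (hmem p).choose_spec.2 ▸ (hmem p).choose.2⟩, by
          obtain ⟨q, hq, hqp⟩ := hmem p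
          have : q = ⟨p.1, hqp ▸ q.2⟩ := Subtype.ext hqp
          exact this ▸ hq⟩
        left_inv := fun _ => rfl
        right_inv := fun _ => rfl }
    rw [Nat.card_congr e]
    congr 1
    exact finsum_eq_of_bijective e e.bijective fun _ => rfl
  · intro p q
    exact char_conj σ _ _

end ParabolicInduction

/-! ### Relative position of two flags -/

section RelativePosition

open Module Submodule

variable {F V : Type*} [Field F] [AddCommGroup V] [Module F V] [FiniteDimensional F V]

/-- An automorphism is assembled from the decompositions `A ⊕ C ⊕ R` and `A ⊕ C' ⊕ R'` of `V`. -/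
lemma exists_linearEquiv_of_finrank_eq {A C C' : Submodule F V} (hC : Disjoint A C)
    (hC' : Disjoint A C') (h : finrank F C = finrank F C') :
    ∃ g : V ≃ₗ[F] V, (∀ v ∈ A, g v = v) ∧ C.map g.toLinearMap = C' := by
  obtain ⟨R, hR⟩ := Submodule.exists_isCompl (A ⊔ C)
  obtain ⟨R', hR'⟩ := Submodule.exists_isCompl (A ⊔ C')
  have e1 : finrank F (A ⊔ C : Submodule F V) = finrank F (A ⊔ C' : Submodule F V) := by
    have h1 := finrank_sup_add_finrank_inf_eq A C
    have h2 := finrank_sup_add_finrank_inf_eq A C'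
    rw [hC.eq_bot, finrank_bot] at h1
    rw [hC'.eq_bot, finrank_bot] at h2
    omega
  have e2 : finrank F R = finrank F R' := by
    have h1 := finrank_add_eq_of_isCompl hR
    have h2 := finrank_add_eq_of_isCompl hR'
    omega
  let φ : C ≃ₗ[F] C' := LinearEquiv.ofFinrankEq _ _ h
  let ψ : R ≃ₗ[F] R' := LinearEquiv.ofFinrankEq _ _ e2
  let s : (A × C) × R →ₗ[F] V := (A.subtype.coprod C.subtype).coprod R.subtype
  let s' : (A × C') × R' →ₗ[F] V := (A.subtype.coprod C'.subtype).coprod R'.subtype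
  have hbij : ∀ {C R : Submodule F V}, Disjoint A C → IsCompl (A ⊔ C) R →
      Function.Bijective ((A.subtype.coprod C.subtype).coprod R.subtype) := by
    intro C R hC hR
    constructor
    · rw [← LinearMap.ker_eq_bot, LinearMap.ker_eq_bot']
      rintro ⟨⟨a, c⟩, r⟩ h0
      have h0' : (a : V) + c + r = 0 := h0
      have hr : (r : V) = 0 := by
        have : (r : V) ∈ (A ⊔ C) ⊓ R :=
          ⟨by rw [eq_neg_of_add_eq_zero_right h0']
              exact neg_mem (add_mem (mem_sup_left a.2) (mem_sup_right c.2)), r.2⟩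
        rwa [hR.inf_eq_bot] at this
      rw [hr, add_zero] at h0'
      have hc : (c : V) = 0 := by
        have : (c : V) ∈ A ⊓ C :=
          ⟨by rw [eq_neg_of_add_eq_zero_right h0']; exact neg_mem a.2, c.2⟩
        rwa [hC.eq_bot] at this
      have ha : (a : V) = 0 := by simpa [hc] using h0'
      ext <;> assumption
    · intro v
      have hv : v ∈ A ⊔ C ⊔ R := by rw [hR.sup_eq_top]; trivial
      obtain ⟨x, hx, r, hr, rfl⟩ := mem_sup.1 hv
      obtain ⟨a, ha, c, hc, rfl⟩ := mem_sup.1 hx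
      exact ⟨((⟨a, ha⟩, ⟨c, hc⟩), ⟨r, hr⟩), rfl⟩
  let t := LinearEquiv.ofBijective s (hbij hC hR)
  let t' := LinearEquiv.ofBijective s' (hbij hC' hR')
  have ht : ∀ x, t x = (x.1.1 : V) + x.1.2 + x.2 := fun x => rfl
  have ht' : ∀ x, t' x = (x.1.1 : V) + x.1.2 + x.2 := fun x => rfl
  let g : V ≃ₗ[F] V :=
    t.symm ≪≫ₗ (((LinearEquiv.refl F A).prodCongr φ).prodCongr ψ) ≪≫ₗ t'
  have hg : ∀ x, g (t x) = (x.1.1 : V) + φ x.1.2 + ψ x.2 := fun x => by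
    simp [g, ht']
  refine ⟨g, fun v hv => ?_, ?_⟩
  · have := hg ((⟨v, hv⟩, 0), 0)
    simpa [ht] using this
  · refine eq_of_le_of_finrank_eq ?_ ((LinearEquiv.finrank_map_eq g C).trans h)
    rintro _ ⟨c, hc, rfl⟩
    have := hg ((0, ⟨c, hc⟩), 0)
    simp only [ht, ZeroMemClass.coe_zero, map_zero, zero_add, add_zero] at this
    exact (congrArg (· ∈ C') this).mpr (φ _).2

/-- Two subspaces of the same dimension with the same intersection with `A` differ by an
automorphism that is the identity on `A`. -/
lemma exists_fixing_map_eq {A B B' : Submodule F V} (hAB : A ⊓ B = A ⊓ B')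
    (h : finrank F B = finrank F B') :
    ∃ g : V ≃ₗ[F] V, (∀ v ∈ A, g v = v) ∧ B.map g.toLinearMap = B' := by
  have key : ∀ B : Submodule F V, ∃ C : Submodule F V, Disjoint A C ∧ (A ⊓ B) ⊔ C = B ∧
      finrank F (A ⊓ B : Submodule F V) + finrank F C = finrank F B := by
    intro B
    obtain ⟨Q, hQ⟩ := Submodule.exists_isCompl (A ⊓ B)
    have h1 : (A ⊓ B) ⊔ (Q ⊓ B) = B := by
      rw [← sup_inf_assoc_of_le _ inf_le_right, hQ.sup_eq_top, top_inf_eq]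
    have h2 : A ⊓ (Q ⊓ B) = ⊥ := by
      rw [inf_comm Q, ← inf_assoc, hQ.inf_eq_bot]
    have h3 : (A ⊓ B) ⊓ (Q ⊓ B) = ⊥ := by
      rw [eq_bot_iff, ← h2]
      exact inf_le_inf_right _ inf_le_left
    refine ⟨Q ⊓ B, disjoint_iff.2 h2, h1, ?_⟩
    have h4 := finrank_sup_add_finrank_inf_eq (A ⊓ B) (Q ⊓ B)
    rw [h1, h3, finrank_bot] at h4
    omega
  obtain ⟨C, hC, hCB, hCd⟩ := key B
  obtain ⟨C', hC', hCB', hCd'⟩ := key B'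
  rw [← hAB] at hCB' hCd'
  obtain ⟨g, hgA, hgC⟩ := exists_linearEquiv_of_finrank_eq hC hC' (by omega)
  refine ⟨g, hgA, ?_⟩
  have hfix : (A ⊓ B).map g.toLinearMap = A ⊓ B := by
    ext v
    constructor
    · rintro ⟨w, hw, rfl⟩
      have := hgA w hw.1
      exact (congrArg (· ∈ A ⊓ B) this).mpr hw
    · exact fun hv => ⟨v, hv, hgA v hv.1⟩
  rw [← hCB, Submodule.map_sup, hfix, hgC, hCB']

/-- Two flags of the same type which meet a subspace `A` in the same flag differ by an automorphism
that is the identity on `A`. -/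
lemma exists_fixing_flag {A : Submodule F V} {B B' : ℕ → Submodule F V} (hB : Monotone B)
    (hB' : Monotone B') (hAB : ∀ j, A ⊓ B j = A ⊓ B' j)
    (h : ∀ j, finrank F (B j) = finrank F (B' j)) (s : ℕ) :
    ∃ g : V ≃ₗ[F] V, (∀ v ∈ A, g v = v) ∧ ∀ j < s, (B j).map g.toLinearMap = B' j := by
  induction s with
  | zero => exact ⟨LinearEquiv.refl F V, fun _ _ => rfl, fun j hj => absurd hj (by omega)⟩
  | succ s ih =>
    obtain ⟨g, hgA, hgB⟩ := ih
    have hmeet : A ⊓ (B s).map g.toLinearMap = A ⊓ B' s := by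
      rw [← hAB]
      ext v
      constructor
      · rintro ⟨hvA, w, hw, hwv⟩
        have : w = v := g.injective (hwv.trans (hgA v hvA).symm)
        exact ⟨hvA, this ▸ hw⟩
      · exact fun hv => ⟨hv.1, v, hv.2, hgA v hv.1⟩
    -- Enlarge `A` by the previous step of the flag; the modular law controls the intersection.
    obtain ⟨D, hD, hD', hDB⟩ : ∃ D : Submodule F V, D ≤ (B s).map g.toLinearMap ∧ D ≤ B' s ∧
        ∀ j < s, B' j ≤ D := by
      rcases s with _ | s
      · exact ⟨⊥, bot_le, bot_le, fun j hj => absurd hj (by omega)⟩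
      · refine ⟨B' s, ?_, hB' (Nat.le_succ s), fun j hj => hB' (by omega)⟩
        rw [← hgB s (by omega)]
        exact map_mono (hB (Nat.le_succ s))
    obtain ⟨g', hgA', hgB'⟩ := exists_fixing_map_eq (A := D ⊔ A) (B := (B s).map g.toLinearMap)
      (B' := B' s) (by
        rw [sup_inf_assoc_of_le _ hD, sup_inf_assoc_of_le _ hD', hmeet])
      ((LinearEquiv.finrank_map_eq g (B s)).trans (h s))
    refine ⟨g ≪≫ₗ g', fun v hv => ?_, fun j hj => ?_⟩
    · rw [LinearEquiv.trans_apply, hgA v hv, hgA' v (mem_sup_right hv)]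
    · have hcomp : (B j).map (g ≪≫ₗ g').toLinearMap =
          ((B j).map g.toLinearMap).map g'.toLinearMap := by
        rw [← map_comp]; rfl
      rw [hcomp]
      rcases Nat.lt_succ_iff_lt_or_eq.1 hj with hj | rfl
      · rw [hgB j hj]
        ext v
        constructor
        · rintro ⟨w, hw, rfl⟩
          exact (congrArg (· ∈ B' j) (hgA' w (mem_sup_left (hDB j hj hw)))).mpr hw
        · exact fun hv => ⟨v, hv, hgA' v (mem_sup_left (hDB j hj hv))⟩
      · exact hgB'

/-- Pairs of flags are classified by the dimensions of the pairwise intersections: an automorphism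
that is correct on `A i` is corrected, without changing it on `A i`, so as to be correct on
`A (i + 1)`. -/
lemma exists_map_flags_eq {A A' B B' : ℕ → Submodule F V} (hA : Monotone A) (hA' : Monotone A')
    (hB : Monotone B) (hB' : Monotone B') {r s : ℕ} (hA0 : A 0 = ⊥) (hA0' : A' 0 = ⊥)
    (hAr : A r = ⊤) (hAr' : A' r = ⊤) (hBs : B s = ⊤) (hBs' : B' s = ⊤)
    (h : ∀ i j, finrank F (A i ⊓ B j : Submodule F V) = finrank F (A' i ⊓ B' j : Submodule F V)) :
    ∃ g : V ≃ₗ[F] V, (∀ i, (A i).map g.toLinearMap = A' i) ∧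
      ∀ j, (B j).map g.toLinearMap = B' j := by
  have key : ∀ i, ∃ g : V ≃ₗ[F] V, (∀ l ≤ i, (A l).map g.toLinearMap = A' l) ∧
      ∀ j ≤ s, (A i ⊓ B j).map g.toLinearMap = A' i ⊓ B' j := by
    intro i
    induction i with
    | zero =>
      refine ⟨LinearEquiv.refl F V, fun l hl => ?_, fun j _ => ?_⟩
      · obtain rfl : l = 0 := by omega
        rw [hA0, hA0', Submodule.map_bot]
      · rw [hA0, hA0', bot_inf_eq, bot_inf_eq, Submodule.map_bot]
    | succ i ih =>
      obtain ⟨g, hgA, hgB⟩ := ih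
      have hinter : ∀ j, (A i ⊓ B j).map g.toLinearMap =
          A' i ⊓ (A (i + 1) ⊓ B j).map g.toLinearMap := fun j => by
        rw [← hgA i le_rfl, ← map_inf _ g.injective, ← inf_assoc,
          inf_eq_left.2 (hA (Nat.le_succ i))]
      have hbig : ∀ j, s ≤ j → B j = ⊤ ∧ B' j = ⊤ := fun j hj =>
        ⟨top_unique (hBs ▸ hB hj), top_unique (hBs' ▸ hB' hj)⟩
      obtain ⟨g', hgA', hgB'⟩ := exists_fixing_flag (A := A' i)
        (B := fun j => (A (i + 1) ⊓ B j).map g.toLinearMap) (B' := fun j => A' (i + 1) ⊓ B' j)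
        (fun a b hab => map_mono (inf_le_inf_left _ (hB hab)))
        (fun a b hab => inf_le_inf_left _ (hB' hab))
        (fun j => by
          rw [← hinter, ← inf_assoc, inf_eq_left.2 (hA' (Nat.le_succ i))]
          rcases le_total j s with hj | hj
          · exact hgB j hj
          · rw [(hbig j hj).1, (hbig j hj).2, inf_top_eq, inf_top_eq, hgA i le_rfl])
        (fun j => (LinearEquiv.finrank_map_eq g _).trans (h _ _)) (s + 1)
      have hcomp : ∀ X : Submodule F V, X.map (g ≪≫ₗ g').toLinearMap =
          (X.map g.toLinearMap).map g'.toLinearMap := fun X => by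
        rw [← map_comp]; rfl
      have hB'' : ∀ j ≤ s, (A (i + 1) ⊓ B j).map (g ≪≫ₗ g').toLinearMap = A' (i + 1) ⊓ B' j :=
        fun j hj => by
          rw [hcomp]
          exact hgB' j (by omega)
      refine ⟨g ≪≫ₗ g', fun l hl => ?_, hB''⟩
      rcases Nat.le_succ_iff.1 hl with hl | rfl
      · rw [hcomp, hgA l hl]
        ext v
        constructor
        · rintro ⟨w, hw, rfl⟩
          exact (congrArg (· ∈ A' l) (hgA' w (hA' hl hw))).mpr hw
        · exact fun hv => ⟨v, hv, hgA' v (hA' hl hv)⟩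
      · have := hB'' s le_rfl
        rwa [hBs, hBs', inf_top_eq, inf_top_eq] at this
  obtain ⟨g, hgA, hgB⟩ := key r
  have htop : (⊤ : Submodule F V).map g.toLinearMap = ⊤ := by
    rw [Submodule.map_top]; exact g.range
  refine ⟨g, fun i => ?_, fun j => ?_⟩
  · rcases le_total i r with hi | hi
    · exact hgA i hi
    · rw [show A i = ⊤ from top_unique (hAr ▸ hA hi), show A' i = ⊤ from top_unique (hAr' ▸ hA' hi),
        htop]
  · rcases le_total j s with hj | hj
    · have := hgB j hj
      rwa [hAr, hAr', top_inf_eq, top_inf_eq] at this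
    · rw [show B j = ⊤ from top_unique (hBs ▸ hB hj), show B' j = ⊤ from top_unique (hBs' ▸ hB' hj),
        htop]

end RelativePosition

/-! ### Matrices with given row and column sums -/

section ContingencyMatrices

/-- The partial sum `c₁ + ⋯ + cᵢ` of a composition, given as a function on `ℕ`. -/
def partialSum (c : ℕ → ℕ) (i : ℕ) : ℕ := ∑ l ∈ Finset.range i, c l

lemma partialSum_zero (c : ℕ → ℕ) : partialSum c 0 = 0 := rfl

lemma partialSum_succ (c : ℕ → ℕ) (i : ℕ) : partialSum c (i + 1) = partialSum c i + c i :=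
  Finset.sum_range_succ c i

lemma partialSum_mono (c : ℕ → ℕ) : Monotone (partialSum c) :=
  monotone_nat_of_le_succ fun i => by rw [partialSum_succ]; omega

lemma partialSum_of_le {c : ℕ → ℕ} {r : ℕ} (hc : ∀ l, r ≤ l → c l = 0) {i : ℕ} (hi : r ≤ i) :
    partialSum c i = partialSum c r := by
  induction i, hi using Nat.le_induction with
  | base => rfl
  | succ i hi ih => rw [partialSum_succ, hc i hi, ih, add_zero]

lemma sum_range_ite_lt {f : ℕ → ℕ} {s j : ℕ} (hf : ∀ b, s ≤ b → f b = 0) :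
    (∑ b ∈ Finset.range s, if b < j then f b else 0) = ∑ b ∈ Finset.range j, f b := by
  rw [← Finset.sum_filter]
  refine Finset.sum_subset (fun b hb => ?_) fun b hb hb' => hf b ?_
  · exact Finset.mem_range.2 (Finset.mem_filter.1 hb).2
  · simp only [Finset.mem_filter, Finset.mem_range, not_and] at hb hb'
    by_contra h
    exact hb' (by omega) hb

/-- The `r × s` matrices of natural numbers with row sums `c` and column sums `d`, extended by
zero to functions on `ℕ × ℕ`. -/
def contingencyMatrices (c : ℕ → ℕ) (r : ℕ) (d : ℕ → ℕ) (s : ℕ) : Set (ℕ → ℕ → ℕ) :=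
  {m | (∀ i < r, ∑ j ∈ Finset.range s, m i j = c i) ∧
    (∀ j < s, ∑ i ∈ Finset.range r, m i j = d j) ∧ ∀ i j, r ≤ i ∨ s ≤ j → m i j = 0}

/-- The sum of the upper left `i × j` block of a matrix. -/
def blockSum (m : ℕ → ℕ → ℕ) (i j : ℕ) : ℕ :=
  ∑ a ∈ Finset.range i, ∑ b ∈ Finset.range j, m a b

lemma blockSum_succ_left (m : ℕ → ℕ → ℕ) (i j : ℕ) :
    blockSum m (i + 1) j = blockSum m i j + ∑ b ∈ Finset.range j, m i b :=
  Finset.sum_range_succ _ _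

lemma blockSum_succ_right (m : ℕ → ℕ → ℕ) (i j : ℕ) :
    blockSum m i (j + 1) = blockSum m i j + ∑ a ∈ Finset.range i, m a j := by
  simp only [blockSum, Finset.sum_range_succ, Finset.sum_add_distrib]

lemma blockSum_injective : Function.Injective blockSum := by
  intro m m' h
  funext a b
  have h1 : ∀ i j, ∑ b ∈ Finset.range j, m i b = ∑ b ∈ Finset.range j, m' i b := fun i j => by
    have h2 := blockSum_succ_left m i j
    have h3 := blockSum_succ_left m' i j
    rw [h] at h2
    omega
  have h2 := h1 a (b + 1)
  rw [Finset.sum_range_succ, Finset.sum_range_succ, h1 a b] at h2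
  omega

lemma blockSum_right_eq {c d : ℕ → ℕ} {r s : ℕ} (hc : ∀ l, r ≤ l → c l = 0) {m : ℕ → ℕ → ℕ}
    (hm : m ∈ contingencyMatrices c r d s) (i : ℕ) : blockSum m i s = partialSum c i := by
  refine Finset.sum_congr rfl fun a _ => ?_
  rcases lt_or_ge a r with ha | ha
  · exact hm.1 a ha
  · rw [hc a ha]
    exact Finset.sum_eq_zero fun b _ => hm.2.2 a b (Or.inl ha)

lemma blockSum_left_eq {c d : ℕ → ℕ} {r s : ℕ} (hd : ∀ l, s ≤ l → d l = 0) {m : ℕ → ℕ → ℕ}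
    (hm : m ∈ contingencyMatrices c r d s) (j : ℕ) : blockSum m r j = partialSum d j := by
  rw [blockSum, Finset.sum_comm]
  refine Finset.sum_congr rfl fun b _ => ?_
  rcases lt_or_ge b s with hb | hb
  · exact hm.2.1 b hb
  · rw [hd b hb]
    exact Finset.sum_eq_zero fun a _ => hm.2.2 a b (Or.inr hb)

/-- A table with nonnegative mixed differences and the right margins is the table of block sums of
a matrix. -/
lemma exists_blockSum_eq {c d : ℕ → ℕ} {r s : ℕ} {R : ℕ → ℕ → ℕ}
    (h0 : ∀ j, R 0 j = 0) (h0' : ∀ i, R i 0 = 0)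
    (hmix : ∀ i j, R (i + 1) j + R i (j + 1) ≤ R (i + 1) (j + 1) + R i j)
    (hs : ∀ i j, s ≤ j → R i j = partialSum c i) (hr : ∀ i j, r ≤ i → R i j = partialSum d j) :
    ∃ m ∈ contingencyMatrices c r d s, blockSum m = R := by
  let m : ℕ → ℕ → ℕ := fun i j => R (i + 1) (j + 1) + R i j - (R (i + 1) j + R i (j + 1))
  have hrow : ∀ i j, ∑ b ∈ Finset.range j, m i b + R i j = R (i + 1) j := fun i j => by
    induction j with
    | zero => simp [h0']
    | succ j ih =>
      rw [Finset.sum_range_succ]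
      have := hmix i j
      simp only [m] at ih ⊢
      omega
  have hblock : blockSum m = R := by
    funext i j
    induction i with
    | zero => simp [blockSum, h0]
    | succ i ih => rw [blockSum_succ_left, ih, ← hrow i j, add_comm]
  refine ⟨m, ⟨fun i _ => ?_, fun j _ => ?_, fun i j hij => ?_⟩, hblock⟩
  · have := hrow i s
    rw [hs _ _ le_rfl, hs _ _ le_rfl, partialSum_succ] at this
    omega
  · have := blockSum_succ_right m r j
    rw [hblock, hr _ _ le_rfl, hr _ _ le_rfl, partialSum_succ] at this
    omega
  · simp only [m]
    rcases hij with hi | hj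
    · rw [hr _ _ hi, hr _ _ hi, hr _ _ (by omega : r ≤ i + 1), hr _ _ (by omega : r ≤ i + 1)]
      omega
    · rw [hs _ _ hj, hs _ _ hj, hs _ _ (by omega : s ≤ j + 1), hs _ _ (by omega : s ≤ j + 1)]
      omega

end ContingencyMatrices

/-! ### Double cosets of parabolic subgroups -/

section DoubleCosets

open Module Submodule

/-- The functions on `T` which vanish outside `p`. -/
def supportedOn (F : Type*) [Field F] {T : Type*} (p : T → Prop) : Submodule F (T → F) where
  carrier := {v | ∀ x, ¬ p x → v x = 0}
  zero_mem' := fun _ _ => rfl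
  add_mem' := by
    intro a b ha hb x hx
    simp [ha x hx, hb x hx]
  smul_mem' := by
    intro c a ha x hx
    simp [ha x hx]

variable {F : Type*} [Field F]

lemma supportedOn_mono {T : Type*} {p q : T → Prop} (h : ∀ x, p x → q x) :
    supportedOn F p ≤ supportedOn F q := fun _ hv x hx => hv x fun hp => hx (h x hp)

lemma supportedOn_inf {T : Type*} (p q : T → Prop) :
    supportedOn F p ⊓ supportedOn F q = supportedOn F fun x => p x ∧ q x := by
  ext v
  constructor
  · rintro ⟨h1, h2⟩ x hx
    by_cases hp : p x
    · exact h2 x fun hq => hx ⟨hp, hq⟩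
    · exact h1 x hp
  · exact fun h => ⟨fun x hx => h x fun hpq => hx hpq.1, fun x hx => h x fun hpq => hx hpq.2⟩

lemma finrank_supportedOn {T : Type*} [Fintype T] (p : T → Prop) [DecidablePred p] :
    finrank F (supportedOn F p) = Fintype.card {x // p x} := by
  let e : supportedOn F p ≃ₗ[F] ({x // p x} → F) :=
    { toFun := fun v x => v.1 x.1
      map_add' := fun _ _ => rfl
      map_smul' := fun _ _ => rfl
      invFun := fun w => ⟨fun x => if h : p x then w ⟨x, h⟩ else 0, fun x hx => dif_neg hx⟩
      left_inv := fun v => by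
        ext x
        by_cases h : p x
        · simp [h]
        · simp [h, v.2 x h]
      right_inv := fun w => by
        ext x
        simp [x.2] }
  rw [e.finrank_eq, finrank_fintype_fun_eq_card]

lemma coordSubspace_eq_supportedOn (n s : ℕ) :
    coordSubspace F n s = supportedOn F fun j : Fin n => (j : ℕ) < s := by
  ext v
  exact forall_congr' fun j => by rw [not_lt]

lemma finrank_coordSubspace {n s : ℕ} (hs : s ≤ n) : finrank F (coordSubspace F n s) = s := by
  rw [coordSubspace_eq_supportedOn, finrank_supportedOn, Fintype.card_subtype]
  rw [Fin.card_filter_val_lt]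
  exact min_eq_right hs

lemma coordSubspace_mono (n : ℕ) : Monotone (coordSubspace F n) :=
  fun _ _ hst _ hv j hj => hv j (hst.trans hj)

lemma coordSubspace_zero (n : ℕ) : coordSubspace F n 0 = ⊥ := by
  rw [eq_bot_iff]
  exact fun v hv => funext fun j => hv j (Nat.zero_le _)

lemma coordSubspace_of_le {n s : ℕ} (hs : n ≤ s) : coordSubspace F n s = ⊤ := by
  rw [eq_top_iff]
  intro v _ j hj
  have := j.2
  omega

lemma exists_GL_of_linearEquiv {n : ℕ} (e : (Fin n → F) ≃ₗ[F] (Fin n → F)) :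
    ∃ g : GL (Fin n) F, (g : Matrix (Fin n) (Fin n) F).mulVecLin = e.toLinearMap := by
  refine ⟨⟨LinearMap.toMatrix' e.toLinearMap, LinearMap.toMatrix' e.symm.toLinearMap, ?_, ?_⟩, ?_⟩
  · rw [← LinearMap.toMatrix'_comp]; simp
  · rw [← LinearMap.toMatrix'_comp]; simp
  · exact LinearMap.toMatrix'.symm_apply_apply e.toLinearMap

variable (F) in
/-- The stabilizer in `GLₙ(F)` of the standard flag whose dimensions are the partial sums of `c`.
For the row lengths of a diagram `D` this is `parabolic F D` by definition. -/
def compositionParabolic (n : ℕ) (c : ℕ → ℕ) : Subgroup (GL (Fin n) F) :=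
  ⨅ i : ℕ, stabilizer F (coordSubspace F n (partialSum c i))

/-- The flag in `Fⁿ` which corresponds to a coset of the stabilizer of the standard flag: the image
of the standard flag under a representative, which does not depend on the choice by
`cosetFlag_mk`. -/
def cosetFlag {n : ℕ} {c : ℕ → ℕ} (x : GL (Fin n) F ⧸ compositionParabolic F n c) (i : ℕ) :
    Submodule F (Fin n → F) :=
  (coordSubspace F n (partialSum c i)).map
    (x.out : Matrix (Fin n) (Fin n) F).mulVecLin

lemma map_mulVecLin_mul {n : ℕ} (g h : GL (Fin n) F) (V : Submodule F (Fin n → F)) :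
    V.map ((g * h : GL (Fin n) F) : Matrix (Fin n) (Fin n) F).mulVecLin =
      (V.map (h : Matrix (Fin n) (Fin n) F).mulVecLin).map
        (g : Matrix (Fin n) (Fin n) F).mulVecLin := by
  rw [Units.val_mul, Matrix.mulVecLin_mul, Submodule.map_comp]

lemma mulVecLin_injective {n : ℕ} (g : GL (Fin n) F) :
    Function.Injective (g : Matrix (Fin n) (Fin n) F).mulVecLin :=
  Matrix.mulVec_injective_of_isUnit g.isUnit

lemma cosetFlag_mk {n : ℕ} {c : ℕ → ℕ} (g : GL (Fin n) F) (i : ℕ) :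
    cosetFlag (g : GL (Fin n) F ⧸ compositionParabolic F n c) i =
      (coordSubspace F n (partialSum c i)).map (g : Matrix (Fin n) (Fin n) F).mulVecLin := by
  obtain ⟨h, hh⟩ := QuotientGroup.mk_out_eq_mul (compositionParabolic F n c) g
  have h1 : h.1 ∈ stabilizer F (coordSubspace F n (partialSum c i)) :=
    (Subgroup.mem_iInf.1 h.2) i
  have h2 : (coordSubspace F n (partialSum c i)).map
    (h.1 : Matrix (Fin n) (Fin n) F).mulVecLin = coordSubspace F n (partialSum c i) := h1
  rw [cosetFlag, hh, map_mulVecLin_mul, h2]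

lemma cosetFlag_smul {n : ℕ} {c : ℕ → ℕ} (g : GL (Fin n) F)
    (x : GL (Fin n) F ⧸ compositionParabolic F n c) (i : ℕ) :
    cosetFlag (g • x) i = (cosetFlag x i).map (g : Matrix (Fin n) (Fin n) F).mulVecLin := by
  obtain ⟨h, rfl⟩ := QuotientGroup.mk_surjective x
  rw [MulAction.Quotient.smul_coe, cosetFlag_mk, cosetFlag_mk, smul_eq_mul, map_mulVecLin_mul]

lemma eq_of_cosetFlag_eq {n : ℕ} {c : ℕ → ℕ}
    {x y : GL (Fin n) F ⧸ compositionParabolic F n c}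
    (h : ∀ i, cosetFlag x i = cosetFlag y i) : x = y := by
  obtain ⟨a, rfl⟩ := QuotientGroup.mk_surjective x
  obtain ⟨b, rfl⟩ := QuotientGroup.mk_surjective y
  rw [QuotientGroup.eq]
  refine Subgroup.mem_iInf.2 fun i => ?_
  change (coordSubspace F n (partialSum c i)).map
    ((a⁻¹ * b : GL (Fin n) F) : Matrix (Fin n) (Fin n) F).mulVecLin = _
  have hi := h i
  rw [cosetFlag_mk, cosetFlag_mk] at hi
  rw [map_mulVecLin_mul, ← hi, ← map_mulVecLin_mul, inv_mul_cancel]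
  simp

section CosetFlag

variable {n : ℕ} {c : ℕ → ℕ} {r : ℕ} (x : GL (Fin n) F ⧸ compositionParabolic F n c)

lemma cosetFlag_mono : Monotone (cosetFlag x) := fun _ _ hij =>
  map_mono (coordSubspace_mono n (partialSum_mono c hij))

lemma cosetFlag_zero : cosetFlag x 0 = ⊥ := by
  rw [cosetFlag, partialSum_zero, coordSubspace_zero, Submodule.map_bot]

variable (hr : partialSum c r = n)

include hr

lemma cosetFlag_of_le {i : ℕ} (hi : r ≤ i) : cosetFlag x i = ⊤ := by
  rw [cosetFlag, coordSubspace_of_le (hr ▸ partialSum_mono c hi), Submodule.map_top,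
    LinearMap.range_eq_top]
  exact LinearMap.injective_iff_surjective.1 (mulVecLin_injective x.out)

lemma finrank_cosetFlag (hc : ∀ l, r ≤ l → c l = 0) (i : ℕ) :
    finrank F (cosetFlag x i) = partialSum c i := by
  rw [cosetFlag, ← (Submodule.equivMapOfInjective _ (mulVecLin_injective x.out) _).finrank_eq,
    finrank_coordSubspace]
  rcases le_total r i with hi | hi
  · rw [partialSum_of_le hc hi, hr]
  · exact hr ▸ partialSum_mono c hi

end CosetFlag

/-- Every flag of the right dimensions comes from a coset. -/
lemma exists_cosetFlag_eq {n : ℕ} {c : ℕ → ℕ} {r : ℕ} (hc : ∀ l, r ≤ l → c l = 0)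
    (hr : partialSum c r = n) {A : ℕ → Submodule F (Fin n → F)} (hA : Monotone A)
    (hAd : ∀ i, finrank F (A i) = partialSum c i) :
    ∃ x : GL (Fin n) F ⧸ compositionParabolic F n c, ∀ i, cosetFlag x i = A i := by
  let x₀ : GL (Fin n) F ⧸ compositionParabolic F n c := ((1 : GL (Fin n) F) : _)
  obtain ⟨g, hg, -⟩ := exists_map_flags_eq (A := cosetFlag x₀) (A' := A) (B := fun _ => ⊤)
    (B' := fun _ => ⊤) (r := r) (s := 0) (cosetFlag_mono x₀) hA monotone_const monotone_const
    (cosetFlag_zero x₀)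
    (finrank_eq_zero.1 (by rw [hAd, partialSum_zero])) (cosetFlag_of_le x₀ hr le_rfl)
    (eq_top_of_finrank_eq (by rw [hAd, hr]; simp)) rfl rfl
    (fun i j => by rw [inf_top_eq, inf_top_eq, hAd, finrank_cosetFlag x₀ hr hc])
  obtain ⟨g', hg'⟩ := exists_GL_of_linearEquiv g
  exact ⟨g' • x₀, fun i => by rw [cosetFlag_smul, hg', hg]⟩

/-- For a basis with `m a b` vectors `t` in position `(a, b)`, the spans of the vectors with `a < i`
and of those with `b < j` form two flags in relative position `m`. -/
lemma exists_flags_of_contingencyMatrix {n : ℕ} {c d : ℕ → ℕ} {r s : ℕ}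
    (hc : ∀ l, r ≤ l → c l = 0) (hd : ∀ l, s ≤ l → d l = 0) (hr : partialSum c r = n)
    (hs : partialSum d s = n) {m : ℕ → ℕ → ℕ} (hm : m ∈ contingencyMatrices c r d s) :
    ∃ (x : GL (Fin n) F ⧸ compositionParabolic F n c)
      (y : GL (Fin n) F ⧸ compositionParabolic F n d),
      ∀ i j, finrank F (cosetFlag x i ⊓ cosetFlag y j : Submodule F (Fin n → F)) =
        blockSum m i j := by
  let T := Σ (a : Fin r) (b : Fin s), Fin (m a b)
  let A : ℕ → Submodule F (T → F) := fun i => supportedOn F fun t => (t.1 : ℕ) < i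
  let B : ℕ → Submodule F (T → F) := fun j => supportedOn F fun t => (t.2.1 : ℕ) < j
  have hcount : ∀ i j, finrank F (A i ⊓ B j : Submodule F (T → F)) = blockSum m i j := by
    intro i j
    rw [supportedOn_inf, finrank_supportedOn, Fintype.card_subtype, Finset.card_filter]
    have h1 : ∀ (a : Fin r) (b : Fin s),
        (∑ _l : Fin (m a b), if (a : ℕ) < i ∧ (b : ℕ) < j then 1 else 0) =
          (fun a b => if a < i then if b < j then m a b else 0 else 0) (a : ℕ) (b : ℕ) :=
      fun a b => by
        by_cases ha : (a : ℕ) < i <;> by_cases hb : (b : ℕ) < j <;> simp [ha, hb]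
    simp only [T, Fintype.sum_sigma, h1]
    have h2 : ∀ a : Fin r, (∑ b : Fin s, if (a : ℕ) < i then if (b : ℕ) < j then m a b else 0
        else 0) = (fun a => if a < i then ∑ b ∈ Finset.range j, m a b else 0) (a : ℕ) := fun a => by
      by_cases ha : (a : ℕ) < i
      · simp only [ha, if_true]
        rw [← sum_range_ite_lt (s := s) fun b hb => hm.2.2 a b (Or.inr hb)]
        exact Fin.sum_univ_eq_sum_range (fun b => if b < j then m a b else 0) s
      · simp [ha]
    simp only [h2]
    rw [Fin.sum_univ_eq_sum_range (fun a => if a < i then ∑ b ∈ Finset.range j, m a b else 0) r]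
    exact sum_range_ite_lt fun a ha => Finset.sum_eq_zero fun b _ => hm.2.2 a b (Or.inl ha)
  have hAs : ∀ i, A i ⊓ B s = A i := fun i =>
    inf_eq_left.2 (supportedOn_mono fun t _ => t.2.1.2)
  have hBr : ∀ j, A r ⊓ B j = B j := fun i =>
    inf_eq_right.2 (supportedOn_mono fun t _ => t.1.2)
  have hAd : ∀ i, finrank F (A i) = partialSum c i := fun i => by
    rw [← hAs, hcount, blockSum_right_eq hc hm]
  have hBd : ∀ j, finrank F (B j) = partialSum d j := fun j => by
    rw [← hBr, hcount, blockSum_left_eq hd hm]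
  have hT : finrank F (T → F) = finrank F (Fin n → F) := by
    have h1 : A r = ⊤ := by
      rw [eq_top_iff]
      intro v _ t ht
      exact absurd t.1.2 ht
    rw [← finrank_top, ← h1, hAd, hr]
    simp
  let e : (T → F) ≃ₗ[F] (Fin n → F) := LinearEquiv.ofFinrankEq _ _ hT
  obtain ⟨x, hx⟩ := exists_cosetFlag_eq hc hr (A := fun i => (A i).map e.toLinearMap)
    (fun i j hij => map_mono (supportedOn_mono fun t ht => lt_of_lt_of_le ht hij))
    (fun i => (LinearEquiv.finrank_map_eq e _).trans (hAd i))
  obtain ⟨y, hy⟩ := exists_cosetFlag_eq hd hs (A := fun i => (B i).map e.toLinearMap)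
    (fun i j hij => map_mono (supportedOn_mono fun t ht => lt_of_lt_of_le ht hij))
    (fun i => (LinearEquiv.finrank_map_eq e _).trans (hBd i))
  refine ⟨x, y, fun i j => ?_⟩
  rw [hx, hy, ← map_inf _ e.injective, ← hcount]
  exact LinearEquiv.finrank_map_eq e _

/-- The double cosets of two parabolic subgroups of `GLₙ(F)` correspond to the matrices of natural
numbers whose row and column sums are the block sizes. -/
lemma card_orbits_eq_ncard {n : ℕ} {c d : ℕ → ℕ} {r s : ℕ}
    (hc : ∀ l, r ≤ l → c l = 0) (hd : ∀ l, s ≤ l → d l = 0) (hr : partialSum c r = n)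
    (hs : partialSum d s = n) :
    Nat.card (MulAction.orbitRel.Quotient (GL (Fin n) F)
      ((GL (Fin n) F ⧸ compositionParabolic F n c) ×
        (GL (Fin n) F ⧸ compositionParabolic F n d))) = (contingencyMatrices c r d s).ncard := by
  let R : (GL (Fin n) F ⧸ compositionParabolic F n c) ×
      (GL (Fin n) F ⧸ compositionParabolic F n d) → ℕ → ℕ → ℕ := fun p i j =>
    finrank F (cosetFlag p.1 i ⊓ cosetFlag p.2 j : Submodule F (Fin n → F))
  have hR : ∀ p q, (MulAction.orbitRel (GL (Fin n) F) _) p q ↔ R p = R q := by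
    intro p q
    constructor
    · rintro ⟨g, rfl⟩
      funext i j
      simp only [R]
      change finrank F (cosetFlag (g • q.1) i ⊓ cosetFlag (g • q.2) j : Submodule F _) = _
      rw [cosetFlag_smul, cosetFlag_smul, ← map_inf _ (mulVecLin_injective g)]
      exact (Submodule.equivMapOfInjective _ (mulVecLin_injective g) _).finrank_eq.symm
    · intro h
      obtain ⟨g, hgA, hgB⟩ := exists_map_flags_eq (cosetFlag_mono q.1) (cosetFlag_mono p.1)
        (cosetFlag_mono q.2) (cosetFlag_mono p.2) (cosetFlag_zero _) (cosetFlag_zero _)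
        (cosetFlag_of_le _ hr le_rfl) (cosetFlag_of_le _ hr le_rfl)
        (cosetFlag_of_le _ hs le_rfl) (cosetFlag_of_le _ hs le_rfl)
        (fun i j => (congrFun (congrFun h i) j).symm)
      obtain ⟨g', hg'⟩ := exists_GL_of_linearEquiv g
      refine ⟨g', Prod.ext (eq_of_cosetFlag_eq fun i => ?_) (eq_of_cosetFlag_eq fun i => ?_)⟩
      · change cosetFlag (g' • q.1) i = _
        rw [cosetFlag_smul, hg', hgA]
      · change cosetFlag (g' • q.2) i = _
        rw [cosetFlag_smul, hg', hgB]
  let R' : MulAction.orbitRel.Quotient (GL (Fin n) F)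
      ((GL (Fin n) F ⧸ compositionParabolic F n c) ×
        (GL (Fin n) F ⧸ compositionParabolic F n d)) → ℕ → ℕ → ℕ :=
    Quotient.lift R fun p q h => (hR p q).1 h
  have hinj : Function.Injective R' := by
    intro p q
    induction p using Quotient.inductionOn with | _ p
    induction q using Quotient.inductionOn with | _ q
    exact fun h => Quotient.sound ((hR p q).2 h)
  have hrange : Set.range R' = blockSum '' contingencyMatrices c r d s := by
    ext f
    constructor
    · rintro ⟨p, rfl⟩
      induction p using Quotient.inductionOn with | _ p
      change R p ∈ _
      obtain ⟨x, y⟩ := p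
      have hinfs : ∀ i j, s ≤ j → R (x, y) i j = partialSum c i := fun i j hj => by
        simp only [R]
        rw [cosetFlag_of_le y hs hj, inf_top_eq, finrank_cosetFlag x hr hc]
      have hinfr : ∀ i j, r ≤ i → R (x, y) i j = partialSum d j := fun i j hi => by
        simp only [R]
        rw [cosetFlag_of_le x hr hi, top_inf_eq, finrank_cosetFlag y hs hd]
      refine exists_blockSum_eq (fun j => ?_) (fun i => ?_) (fun i j => ?_) hinfs hinfr
      · simp only [R]
        rw [cosetFlag_zero, bot_inf_eq, finrank_bot]
      · simp only [R]
        rw [cosetFlag_zero, inf_bot_eq, finrank_bot]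
      -- The mixed difference is the codimension of `A i ∩ B (j + 1) + A (i + 1) ∩ B j` in
      -- `A (i + 1) ∩ B (j + 1)`.
      · simp only [R]
        have h1 := finrank_sup_add_finrank_inf_eq (cosetFlag x (i + 1) ⊓ cosetFlag y j)
          (cosetFlag x i ⊓ cosetFlag y (j + 1))
        have h2 : (cosetFlag x (i + 1) ⊓ cosetFlag y j) ⊓ (cosetFlag x i ⊓ cosetFlag y (j + 1)) =
            cosetFlag x i ⊓ cosetFlag y j := by
          rw [inf_inf_inf_comm, inf_eq_right.2 (cosetFlag_mono x (Nat.le_succ i)),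
            inf_eq_left.2 (cosetFlag_mono y (Nat.le_succ j))]
        have h3 : finrank F ((cosetFlag x (i + 1) ⊓ cosetFlag y j) ⊔
            (cosetFlag x i ⊓ cosetFlag y (j + 1)) : Submodule F (Fin n → F)) ≤
            finrank F (cosetFlag x (i + 1) ⊓ cosetFlag y (j + 1) : Submodule F (Fin n → F)) :=
          finrank_mono (sup_le (inf_le_inf_left _ (cosetFlag_mono y (Nat.le_succ j)))
            (inf_le_inf_right _ (cosetFlag_mono x (Nat.le_succ i))))
        rw [h2] at h1
        omega
    · rintro ⟨m, hm, rfl⟩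
      obtain ⟨x, y, hxy⟩ := exists_flags_of_contingencyMatrix (F := F) hc hd hr hs hm
      exact ⟨Quotient.mk _ (x, y), funext fun i => funext fun j => hxy i j⟩
  rw [← Nat.card_range_of_injective hinj, hrange,
    ← Set.ncard_image_of_injective _ blockSum_injective]
  rfl

end DoubleCosets

/-! ### Young diagrams and their rows -/

section Diagrams

lemma eq_of_rowLen_eq {D E : YoungDiagram} (h : ∀ i, D.rowLen i = E.rowLen i) : D = E := by
  apply YoungDiagram.ext
  ext ⟨i, j⟩
  rw [YoungDiagram.mem_cells, YoungDiagram.mem_cells, YoungDiagram.mem_iff_lt_rowLen,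
    YoungDiagram.mem_iff_lt_rowLen, h]

lemma rowLen_eq_zero_of_card_le {D : YoungDiagram} {i : ℕ} (h : D.card ≤ i) : D.rowLen i = 0 := by
  by_contra hne
  have h1 : (Finset.range (i + 1)).image (fun l => (l, 0)) ⊆ D.cells := by
    intro x hx
    obtain ⟨l, hl, rfl⟩ := Finset.mem_image.1 hx
    rw [YoungDiagram.mem_cells, YoungDiagram.mem_iff_lt_rowLen]
    have := D.rowLen_anti l i (by have := Finset.mem_range.1 hl; omega)
    omega
  have h2 := Finset.card_le_card h1
  rw [Finset.card_image_of_injective _ (fun a b hab => congrArg Prod.fst hab),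
    Finset.card_range] at h2
  have : D.cells.card = D.card := rfl
  omega

lemma card_eq_partialSum {D : YoungDiagram} {M : ℕ} (h : ∀ i, M ≤ i → D.rowLen i = 0) :
    D.card = partialSum D.rowLen M := by
  have h1 : D.cells = ((Finset.range M).sigma fun i => Finset.range (D.rowLen i)).map
      (Equiv.sigmaEquivProd ℕ ℕ).toEmbedding := by
    ext ⟨i, j⟩
    rw [YoungDiagram.mem_cells, YoungDiagram.mem_iff_lt_rowLen]
    simp only [Finset.mem_map_equiv, Equiv.sigmaEquivProd_symm_apply, Finset.mem_sigma,
      Finset.mem_range]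
    constructor
    · intro hj
      refine ⟨?_, hj⟩
      by_contra hM
      have := h i (by omega)
      omega
    · exact fun hj => hj.2
  rw [YoungDiagram.card, h1, Finset.card_map, Finset.card_sigma]
  simp [partialSum]

lemma le_iff_rowLen {D E : YoungDiagram} : D ≤ E ↔ ∀ i, D.rowLen i ≤ E.rowLen i := by
  constructor
  · intro h i
    by_contra hlt
    push Not at hlt
    have h1 : (i, E.rowLen i) ∈ D := YoungDiagram.mem_iff_lt_rowLen.2 hlt
    have h2 := YoungDiagram.mem_iff_lt_rowLen.1 (h h1)
    omega
  · rintro h ⟨i, j⟩ hij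
    exact YoungDiagram.mem_iff_lt_rowLen.2
      (lt_of_lt_of_le (YoungDiagram.mem_iff_lt_rowLen.1 hij) (h i))

lemma card_mono {D E : YoungDiagram} (h : D ≤ E) : D.card ≤ E.card :=
  Finset.card_le_card (YoungDiagram.cells_subset_iff.2 h)

/-- A horizontal strip is an interlacing of row lengths. -/
lemma isHorizontalStrip_iff {D E : YoungDiagram} :
    IsHorizontalStrip D E ↔ ∀ i, D.rowLen i ≤ E.rowLen i ∧ E.rowLen (i + 1) ≤ D.rowLen i := by
  rw [IsHorizontalStrip, le_iff_rowLen, forall_and]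
  refine and_congr_right fun _ => ⟨fun h i => ?_, fun h j => ?_⟩
  · by_contra hlt
    push Not at hlt
    have h1 : (i + 1, D.rowLen i) ∈ E := YoungDiagram.mem_iff_lt_rowLen.2 hlt
    have h2 := YoungDiagram.mem_iff_lt_colLen.1 h1
    have h3 := h (D.rowLen i)
    have h4 : (i, D.rowLen i) ∈ D := YoungDiagram.mem_iff_lt_colLen.2 (by omega)
    exact lt_irrefl _ (YoungDiagram.mem_iff_lt_rowLen.1 h4)
  · by_contra hlt
    push Not at hlt
    have h1 : (D.colLen j + 1, j) ∈ E := YoungDiagram.mem_iff_lt_colLen.2 hlt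
    have h2 := YoungDiagram.mem_iff_lt_rowLen.1 h1
    have h3 : (D.colLen j, j) ∈ D :=
      YoungDiagram.mem_iff_lt_rowLen.2 (lt_of_lt_of_le h2 (h _))
    exact lt_irrefl _ (YoungDiagram.mem_iff_lt_colLen.1 h3)

/-- The diagram with row lengths `f`, when `f` is weakly decreasing and vanishes from `M` on. For
other `f` it is the largest diagram with at most `M` rows whose row lengths are bounded by `f`. -/
def diagramOfRows (f : ℕ → ℕ) (M : ℕ) : YoungDiagram where
  cells := (Finset.range M ×ˢ Finset.range (f 0)).filter fun c => ∀ i ≤ c.1, c.2 < f i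
  isLowerSet := by
    rintro ⟨i, j⟩ ⟨i', j'⟩ ⟨hi, hj⟩ h
    simp only [Finset.coe_filter, Finset.mem_product, Finset.mem_range,
      Set.mem_ofPred_eq] at hi hj h ⊢
    exact ⟨⟨by omega, by omega⟩, fun l hl => lt_of_le_of_lt hj (h.2 l (by omega))⟩

lemma rowLen_diagramOfRows {f : ℕ → ℕ} {M : ℕ} (hf : ∀ i, f (i + 1) ≤ f i)
    (hM : ∀ i, M ≤ i → f i = 0) (i : ℕ) : (diagramOfRows f M).rowLen i = f i := by
  have hanti : Antitone f := antitone_nat_of_succ_le hf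
  have hmem : ∀ j, (i, j) ∈ diagramOfRows f M ↔ j < f i := by
    intro j
    rw [← YoungDiagram.mem_cells]
    simp only [diagramOfRows, Finset.mem_filter, Finset.mem_product, Finset.mem_range]
    constructor
    · exact fun h => h.2 i le_rfl
    · intro h
      refine ⟨⟨?_, lt_of_lt_of_le h (hanti (Nat.zero_le i))⟩,
        fun l hl => lt_of_lt_of_le h (hanti hl)⟩
      by_contra hi
      have := hM i (by omega)
      omega
  have h1 : ∀ j, j < (diagramOfRows f M).rowLen i ↔ j < f i := fun j => by
    rw [← YoungDiagram.mem_iff_lt_rowLen, hmem]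
  have h2 := h1 (f i)
  have h3 := h1 ((diagramOfRows f M).rowLen i)
  omega

lemma finite_diagrams (n : ℕ) : {D : YoungDiagram | D.card = n}.Finite := by
  refine Set.Finite.of_finite_image (f := fun D : YoungDiagram => fun i : Fin n => D.rowLen i)
    (Set.Finite.subset (Set.finite_Iic fun _ => n) ?_) ?_
  · rintro _ ⟨D, hD, rfl⟩ i
    have h1 : D.card = n := hD
    have h2 : (D.row i).card ≤ D.card := Finset.card_le_card (Finset.filter_subset _ _)
    have h3 := D.rowLen_eq_card (i := i)
    change D.rowLen i ≤ n
    omega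
  · intro D hD E hE h
    refine eq_of_rowLen_eq fun i => ?_
    have h1 : D.card = n := hD
    have h2 : E.card = n := hE
    rcases lt_or_ge i n with hi | hi
    · exact congrFun h ⟨i, hi⟩
    · rw [rowLen_eq_zero_of_card_le (by omega), rowLen_eq_zero_of_card_le (by omega)]

/-- The Young diagrams with `n` boxes. -/
def diagrams (n : ℕ) : Finset YoungDiagram := (finite_diagrams n).toFinset

@[simp]
lemma mem_diagrams {n : ℕ} {D : YoungDiagram} : D ∈ diagrams n ↔ D.card = n := by
  simp [diagrams]

instance (n : ℕ) : Fintype (Diagram n) :=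
  Fintype.subtype (diagrams n) fun _ => mem_diagrams

lemma sum_diagrams {M : Type*} [AddCommMonoid M] (n : ℕ) (f : YoungDiagram → M) :
    ∑ D ∈ diagrams n, f D = ∑ D : Diagram n, f D.1 :=
  Finset.sum_subtype _ (fun _ => mem_diagrams) f

end Diagrams

/-! ### Adding and removing horizontal strips -/

section Commutation

open Classical in
/-- Row by row, the diagrams `ν` that contain both `D` and `E` with horizontal strips as
differences and the diagrams `κ` contained in both of them with this property fill the same
intervals, apart from the first row of `ν`. The reflection
`κᵢ = min(dᵢ, eᵢ) + max(dᵢ₊₁, eᵢ₊₁) - νᵢ₊₁` of these intervals is the bijection; the surplus of the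
first row of `ν` over `max(d₀, e₀)` is `t`. If `ν` has `b` boxes more than `D` and `a` boxes
more than `E`, then `κ` has `a - t` boxes less than `D` and `b - t` boxes less than `E`. -/
lemma card_common_superdiagrams {D E : YoungDiagram} {p q a b : ℕ} (hD : D.card = p)
    (hE : E.card = q) (h : p + b = q + a) :
    ((diagrams (q + a)).filter fun N => IsHorizontalStrip E N ∧ IsHorizontalStrip D N).card =
      ∑ t ∈ (Finset.range (a + 1)).filter (fun t => t ≤ b ∧ b ≤ q + t),
        ((diagrams (q + t - b)).filter fun K =>
          IsHorizontalStrip K E ∧ IsHorizontalStrip K D).card := by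
  rw [← Finset.card_sigma]
  let lo : ℕ → ℕ := fun i => min (D.rowLen i) (E.rowLen i)
  let hi : ℕ → ℕ := fun i => max (D.rowLen i) (E.rowLen i)
  -- A common bound for the number of rows.
  set M := p + q + a + 1 with hM
  have hDM : ∀ i, p + q ≤ i → D.rowLen i = 0 := fun i hi => rowLen_eq_zero_of_card_le (by omega)
  have hEM : ∀ i, p + q ≤ i → E.rowLen i = 0 := fun i hi => rowLen_eq_zero_of_card_le (by omega)
  -- The relation between the numbers of boxes.
  have hcard : ∀ K N : YoungDiagram, (∀ i, M ≤ i → K.rowLen i = 0) → (∀ i, M ≤ i → N.rowLen i = 0) →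
      (∀ i, K.rowLen i + N.rowLen (i + 1) = lo i + hi (i + 1)) →
      K.card + N.card + hi 0 = p + q + N.rowLen 0 := by
    intro K N hK hN hKN
    have key : ∀ i, partialSum K.rowLen i + partialSum N.rowLen (i + 1) + hi 0 =
        partialSum D.rowLen i + partialSum E.rowLen i + N.rowLen 0 + hi i := by
      intro i
      induction i with
      | zero => simp [partialSum]
      | succ i ih =>
        have h1 := hKN i
        rw [partialSum_succ K.rowLen, partialSum_succ N.rowLen (i + 1), partialSum_succ D.rowLen,
          partialSum_succ E.rowLen]
        simp only [lo, hi] at h1 ih ⊢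
        omega
    have h1 := key M
    rw [← card_eq_partialSum fun i hi => hDM i (by omega),
      ← card_eq_partialSum fun i hi => hEM i (by omega), ← card_eq_partialSum hK,
      ← card_eq_partialSum (M := M + 1) fun i hi => hN i (by omega), hD, hE] at h1
    have h2 : hi M = 0 := by simp [hi, hDM M (by omega), hEM M (by omega)]
    omega
  -- For horizontal strips no subtraction is truncated, as the subtrahend is at most `lo i`.
  let down : YoungDiagram → YoungDiagram := fun N =>
    diagramOfRows (fun i => lo i + hi (i + 1) - N.rowLen (i + 1)) M
  let up : ℕ → YoungDiagram → YoungDiagram := fun t K =>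
    diagramOfRows (fun
      | 0 => hi 0 + t
      | i + 1 => lo i + hi (i + 1) - K.rowLen i) (M + 1)
  have hdown : ∀ N, IsHorizontalStrip E N → IsHorizontalStrip D N →
      (∀ i, (down N).rowLen i = lo i + hi (i + 1) - N.rowLen (i + 1)) ∧
      IsHorizontalStrip (down N) E ∧ IsHorizontalStrip (down N) D := by
    intro N hEN hDN
    rw [isHorizontalStrip_iff] at hEN hDN
    have hr : ∀ i, (down N).rowLen i = lo i + hi (i + 1) - N.rowLen (i + 1) := by
      refine fun i => rowLen_diagramOfRows (fun i => ?_) (fun i hi' => ?_) i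
      · have h1 := hEN i
        have h2 := hDN i
        have h3 := hEN (i + 1)
        have h4 := hDN (i + 1)
        have h5 := hEN (i + 1 + 1)
        have h6 := hDN (i + 1 + 1)
        simp only [lo, hi]
        omega
      · simp [lo, hi, hDM i (by omega), hEM i (by omega), hDM (i + 1) (by omega),
          hEM (i + 1) (by omega)]
    rw [isHorizontalStrip_iff, isHorizontalStrip_iff]
    refine ⟨hr, fun i => ?_, fun i => ?_⟩
    all_goals
      have h1 := hEN i
      have h2 := hDN i
      have h3 := hEN (i + 1)
      have h4 := hDN (i + 1)
      have h5 := hEN (i + 1 + 1)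
      have h6 := hDN (i + 1 + 1)
      rw [hr]
      simp only [lo, hi]
      omega
  have hup : ∀ t K, IsHorizontalStrip K E → IsHorizontalStrip K D →
      (up t K).rowLen 0 = hi 0 + t ∧
      (∀ i, (up t K).rowLen (i + 1) = lo i + hi (i + 1) - K.rowLen i) ∧
      IsHorizontalStrip E (up t K) ∧ IsHorizontalStrip D (up t K) := by
    intro t K hKE hKD
    rw [isHorizontalStrip_iff] at hKE hKD
    have hr : ∀ i, (up t K).rowLen i = (fun
      | 0 => hi 0 + t
      | i + 1 => lo i + hi (i + 1) - K.rowLen i : ℕ → ℕ) i := by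
      refine fun i => rowLen_diagramOfRows (fun i => ?_) (fun i hi' => ?_) i
      · rcases i with _ | i
        · have h1 := hKE 0
          have h2 := hKD 0
          simp only [lo, hi]
          omega
        · have h1 := hKE i
          have h2 := hKD i
          have h3 := hKE (i + 1)
          have h4 := hKD (i + 1)
          simp only [lo, hi]
          omega
      · obtain ⟨j, rfl⟩ : ∃ j, i = j + 1 := ⟨i - 1, by omega⟩
        simp [lo, hi, hDM j (by omega), hEM j (by omega), hDM (j + 1) (by omega),
          hEM (j + 1) (by omega)]
    have hr0 : (up t K).rowLen 0 = hi 0 + t := hr 0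
    have hrs : ∀ i, (up t K).rowLen (i + 1) = lo i + hi (i + 1) - K.rowLen i := fun i => hr (i + 1)
    rw [isHorizontalStrip_iff, isHorizontalStrip_iff]
    refine ⟨hr0, hrs, fun i => ?_, fun i => ?_⟩
    all_goals
      rcases i with _ | i
      · have h1 := hKE 0
        have h2 := hKD 0
        rw [hr0, hrs]
        simp only [lo, hi]
        omega
      · have h1 := hKE i
        have h2 := hKD i
        have h3 := hKE (i + 1)
        have h4 := hKD (i + 1)
        rw [hrs, hrs]
        simp only [lo, hi]
        omega
  refine Finset.card_nbij' (fun N => ⟨N.rowLen 0 - hi 0, down N⟩) (fun x => up x.1 x.2)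
    ?_ ?_ ?_ ?_
  · intro N hN
    simp only [Finset.coe_filter, Set.mem_ofPred_eq, mem_diagrams] at hN
    obtain ⟨hNc, hEN, hDN⟩ := hN
    obtain ⟨hr, hKE, hKD⟩ := hdown N hEN hDN
    have hEN' := isHorizontalStrip_iff.1 hEN
    have hDN' := isHorizontalStrip_iff.1 hDN
    have hc := hcard (down N) N
      (fun i hi' => rowLen_eq_zero_of_card_le (by have := card_mono hKE.1; omega))
      (fun i hi' => rowLen_eq_zero_of_card_le (by omega))
      (fun i => by
        have h1 := hEN' i
        have h2 := hDN' i
        have h3 := hEN' (i + 1)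
        have h4 := hDN' (i + 1)
        rw [hr]
        simp only [lo, hi]
        omega)
    have h1 := card_mono hKE.1
    have h2 := card_mono hKD.1
    have h5 : hi 0 ≤ N.rowLen 0 := max_le (hDN' 0).1 (hEN' 0).1
    simp only [Finset.coe_sigma, Set.mem_sigma_iff, Finset.coe_filter, Set.mem_ofPred_eq,
      Finset.mem_range, mem_diagrams]
    refine ⟨⟨?_, ?_, ?_⟩, ?_, hKE, hKD⟩ <;> omega
  · rintro ⟨t, K⟩ hx
    simp only [Finset.coe_sigma, Set.mem_sigma_iff, Finset.coe_filter, Set.mem_ofPred_eq,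
      Finset.mem_range, mem_diagrams] at hx
    obtain ⟨⟨hta, htb, hbt⟩, hKc, hKE, hKD⟩ := hx
    obtain ⟨hr0, hrs, hEN, hDN⟩ := hup t K hKE hKD
    have hKE' := isHorizontalStrip_iff.1 hKE
    have hKD' := isHorizontalStrip_iff.1 hKD
    have hc := hcard K (up t K)
      (fun i hi' => rowLen_eq_zero_of_card_le (by have := card_mono hKE.1; omega))
      (fun i hi' => by
        obtain ⟨j, rfl⟩ : ∃ j, i = j + 1 := ⟨i - 1, by omega⟩
        rw [hrs]
        simp [lo, hi, hDM j (by omega), hEM j (by omega), hDM (j + 1) (by omega),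
          hEM (j + 1) (by omega)])
      (fun i => by
        have h1 := hKE' i
        have h2 := hKD' i
        rw [hrs]
        simp only [lo, hi]
        omega)
    simp only [Finset.coe_filter, Set.mem_ofPred_eq, mem_diagrams]
    exact ⟨by omega, hEN, hDN⟩
  · intro N hN
    simp only [Finset.coe_filter, Set.mem_ofPred_eq, mem_diagrams] at hN
    obtain ⟨hNc, hEN, hDN⟩ := hN
    obtain ⟨hr, hKE, hKD⟩ := hdown N hEN hDN
    obtain ⟨hr0, hrs, -, -⟩ := hup (N.rowLen 0 - hi 0) (down N) hKE hKD
    have hEN' := isHorizontalStrip_iff.1 hEN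
    have hDN' := isHorizontalStrip_iff.1 hDN
    refine eq_of_rowLen_eq fun i => ?_
    rcases i with _ | i
    · have h5 : hi 0 ≤ N.rowLen 0 := max_le (hDN' 0).1 (hEN' 0).1
      simp only [hr0]
      omega
    · have h1 := hEN' i
      have h2 := hDN' i
      have h3 := hEN' (i + 1)
      have h4 := hDN' (i + 1)
      simp only [hrs, hr]
      simp only [lo, hi]
      omega
  · rintro ⟨t, K⟩ hx
    simp only [Finset.coe_sigma, Set.mem_sigma_iff, Finset.coe_filter, Set.mem_ofPred_eq,
      Finset.mem_range, mem_diagrams] at hx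
    obtain ⟨-, -, hKE, hKD⟩ := hx
    obtain ⟨hr0, hrs, hEN, hDN⟩ := hup t K hKE hKD
    obtain ⟨hr, -, -⟩ := hdown _ hEN hDN
    have h1 : (up t K).rowLen 0 - hi 0 = t := by omega
    have h2 : down (up t K) = K := eq_of_rowLen_eq fun i => by
      have h1 := isHorizontalStrip_iff.1 hKE i
      have h2 := isHorizontalStrip_iff.1 hKD i
      rw [hr, hrs]
      simp only [lo, hi]
      omega
    simp only [h1, h2]

end Commutation

/-! ### Kostka numbers -/

section Kostka

lemma diagrams_zero : diagrams 0 = {⊥} := by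
  ext N
  rw [mem_diagrams, Finset.mem_singleton]
  refine ⟨fun hN => eq_of_rowLen_eq fun i => ?_, fun h => h ▸ rfl⟩
  rw [rowLen_eq_zero_of_card_le (by omega), rowLen_eq_zero_of_card_le (Nat.zero_le i)]

lemma isHorizontalStrip_bot : IsHorizontalStrip ⊥ ⊥ := isHorizontalStrip_iff.2 fun i => by
  rw [rowLen_eq_zero_of_card_le (Nat.zero_le i), rowLen_eq_zero_of_card_le (Nat.zero_le _)]
  exact ⟨le_rfl, le_rfl⟩

open Classical in
/-- The Kostka number: the number of ways to build `D` from the empty diagram by successively adding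
horizontal strips of sizes `c 0, …, c (r - 1)`. The size of the last strip is not checked, so this
is meaningful only if `D` has `partialSum c r` boxes. -/
def kostka (c : ℕ → ℕ) : ℕ → YoungDiagram → ℕ
  | 0, D => if D = ⊥ then 1 else 0
  | r + 1, D => ∑ N ∈ diagrams (partialSum c r),
      if IsHorizontalStrip N D then kostka c r N else 0

lemma kostka_zero (c : ℕ → ℕ) (D : YoungDiagram) [Decidable (D = ⊥)] :
    kostka c 0 D = if D = ⊥ then 1 else 0 := by
  rw [kostka]; congr

open Classical in
lemma kostka_succ (c : ℕ → ℕ) (r : ℕ) (D : YoungDiagram) :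
    kostka c (r + 1) D = ∑ N ∈ diagrams (partialSum c r),
      if IsHorizontalStrip N D then kostka c r N else 0 := rfl

lemma kostka_bot {c : ℕ → ℕ} {r : ℕ} (h : partialSum c r = 0) : kostka c r ⊥ = 1 := by
  classical
  induction r with
  | zero => rw [kostka_zero, if_pos rfl]
  | succ r ih =>
    have h0 : partialSum c r = 0 := by
      rw [partialSum_succ] at h
      omega
    rw [kostka_succ, h0, diagrams_zero, Finset.sum_singleton, if_pos isHorizontalStrip_bot, ih h0]

lemma partialSum_congr {c c' : ℕ → ℕ} {r : ℕ} (h : ∀ i < r, c i = c' i) :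
    partialSum c r = partialSum c' r :=
  Finset.sum_congr rfl fun i hi => h i (Finset.mem_range.1 hi)

lemma kostka_congr {c c' : ℕ → ℕ} {r : ℕ} (h : ∀ i < r, c i = c' i) (D : YoungDiagram) :
    kostka c r D = kostka c' r D := by
  classical
  induction r generalizing D with
  | zero => rw [kostka_zero, kostka_zero]
  | succ r ih =>
    rw [kostka_succ, kostka_succ, partialSum_congr fun i hi => h i (by omega)]
    exact Finset.sum_congr rfl fun N _ => by rw [ih fun i hi => h i (by omega)]

open Classical in
/-- The sequences `i` with `i ≤ d` which are supported on the first `s` entries and have sum `a`. -/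
def boundedCompositions (s a : ℕ) (d : ℕ → ℕ) : Finset (ℕ → ℕ) :=
  (Finset.piAntidiag (Finset.range s) a).filter fun i => ∀ j, i j ≤ d j

lemma mem_boundedCompositions {s a : ℕ} {d i : ℕ → ℕ} :
    i ∈ boundedCompositions s a d ↔
      partialSum i s = a ∧ (∀ j, s ≤ j → i j = 0) ∧ ∀ j, i j ≤ d j := by
  simp only [boundedCompositions, Finset.mem_filter, Finset.mem_piAntidiag, Finset.mem_range,
    partialSum, and_assoc]
  refine and_congr_right fun _ => and_congr_left fun _ => forall_congr' fun j => ?_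
  rw [not_imp_comm, not_lt]

lemma partialSum_sub {s a : ℕ} {d i : ℕ → ℕ} (hi : i ∈ boundedCompositions s a d) :
    partialSum (d - i) s + a = partialSum d s := by
  obtain ⟨h1, -, h3⟩ := mem_boundedCompositions.1 hi
  rw [← h1, partialSum, partialSum, ← Finset.sum_add_distrib]
  exact Finset.sum_congr rfl fun j _ => by
    have := h3 j
    simp only [Pi.sub_apply]
    omega

open Function in
lemma sum_boundedCompositions_succ {M : Type*} [AddCommMonoid M] (s a : ℕ) (d : ℕ → ℕ)
    (f : (ℕ → ℕ) → M) :
    ∑ i ∈ boundedCompositions (s + 1) a d, f i =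
      ∑ t ∈ (Finset.range (a + 1)).filter (· ≤ d s), ∑ i ∈ boundedCompositions s (a - t) d,
        f (update i s t) := by
  rw [Finset.sum_sigma']
  refine Finset.sum_nbij' (fun i => ⟨i s, update i s 0⟩) (fun x => update x.2 s x.1) ?_ ?_ ?_ ?_ ?_
  · intro i hi
    obtain ⟨h1, h2, h3⟩ := mem_boundedCompositions.1 hi
    rw [partialSum_succ] at h1
    simp only [Finset.mem_sigma, Finset.mem_filter, Finset.mem_range, mem_boundedCompositions]
    refine ⟨⟨by omega, h3 s⟩, ?_, fun j hj => ?_, fun j => ?_⟩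
    · rw [partialSum_congr (c' := i) fun j hj => update_of_ne (by omega) _ _]
      omega
    · rcases eq_or_ne j s with rfl | hne
      · exact update_self _ _ _
      · rw [update_of_ne hne]
        exact h2 j (by omega)
    · rcases eq_or_ne j s with rfl | hne
      · rw [update_self]; omega
      · rw [update_of_ne hne]
        exact h3 j
  · rintro ⟨t, i⟩ hx
    simp only [Finset.mem_sigma, Finset.mem_filter, Finset.mem_range, mem_boundedCompositions] at hx
    obtain ⟨⟨hta, htd⟩, h1, h2, h3⟩ := hx
    change t < a + 1 at hta
    change partialSum i s = a - t at h1
    refine mem_boundedCompositions.2 ⟨?_, fun j hj => ?_, fun j => ?_⟩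
    · rw [partialSum_succ, partialSum_congr (c' := i) fun j hj => update_of_ne (by omega) _ _,
        update_self]
      change partialSum i s + t = a
      omega
    · change update i s t j = 0
      rw [update_of_ne (by omega)]
      exact h2 j (by omega)
    · change update i s t j ≤ d j
      rcases eq_or_ne j s with rfl | hne
      · rwa [update_self]
      · rw [update_of_ne hne]
        exact h3 j
  · intro i _
    simp
  · rintro ⟨t, i⟩ hx
    simp only [Finset.mem_sigma, Finset.mem_filter, Finset.mem_range, mem_boundedCompositions] at hx
    have h2 := hx.2.2.1 s le_rfl
    have h3 : update i s 0 = i := by rw [← h2, update_eq_self]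
    simp [h3]
  · intro i _
    simp

open Classical in
/-- The sum of the Kostka numbers of the diagrams obtained from `E` by adding a horizontal strip:
removing boxes from the diagrams that are counted by `kostka d s` amounts to removing them from the
strips. -/
lemma sum_kostka_superdiagrams (s : ℕ) (d : ℕ → ℕ) (q a : ℕ) (h : q + a = partialSum d s)
    (E : YoungDiagram) (hE : E.card = q) :
    (∑ N ∈ diagrams (q + a), if IsHorizontalStrip E N then kostka d s N else 0) =
      ∑ i ∈ boundedCompositions s a d, kostka (d - i) s E := by
  induction s generalizing q a E with
  | zero =>
    obtain ⟨rfl, rfl⟩ : q = 0 ∧ a = 0 := by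
      rw [partialSum_zero] at h
      omega
    have hb : boundedCompositions 0 0 d = {0} := by
      ext i
      rw [mem_boundedCompositions, Finset.mem_singleton]
      constructor
      · exact fun h => funext fun j => h.2.1 j (Nat.zero_le j)
      · rintro rfl
        exact ⟨rfl, fun _ _ => rfl, fun j => Nat.zero_le _⟩
    obtain rfl : E = ⊥ := by rwa [← mem_diagrams, diagrams_zero, Finset.mem_singleton] at hE
    rw [add_zero, diagrams_zero, hb, Finset.sum_singleton, Finset.sum_singleton,
      if_pos isHorizontalStrip_bot, kostka_zero, kostka_zero]
  | succ s ih =>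
    rw [partialSum_succ] at h
    set p := partialSum d s with hp
    set b := d s with hb
    have h1 : (∑ N ∈ diagrams (q + a), if IsHorizontalStrip E N then kostka d (s + 1) N else 0) =
        ∑ D ∈ diagrams p, kostka d s D * ((diagrams (q + a)).filter fun N =>
          IsHorizontalStrip E N ∧ IsHorizontalStrip D N).card := by
      simp only [kostka_succ, Finset.card_filter, Finset.mul_sum]
      rw [Finset.sum_comm]
      refine Finset.sum_congr rfl fun N _ => ?_
      rw [← hp]
      by_cases hN : IsHorizontalStrip E N
      · simp only [hN, if_true, true_and]
        exact Finset.sum_congr rfl fun D _ => by simp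
      · simp [hN]
    have h2 : ∀ D ∈ diagrams p, ((diagrams (q + a)).filter fun N =>
          IsHorizontalStrip E N ∧ IsHorizontalStrip D N).card =
        ∑ t ∈ (Finset.range (a + 1)).filter (fun t => t ≤ b ∧ b ≤ q + t),
          ∑ K ∈ diagrams (q + t - b),
            if IsHorizontalStrip K E ∧ IsHorizontalStrip K D then 1 else 0 := fun D hD => by
      rw [card_common_superdiagrams (mem_diagrams.1 hD) hE h.symm]
      simp only [Finset.card_filter]
    rw [h1, Finset.sum_congr rfl fun D hD => by rw [h2 D hD], sum_boundedCompositions_succ]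
    simp only [Finset.mul_sum]
    rw [Finset.sum_comm]
    have h3 : ∀ t ∈ (Finset.range (a + 1)).filter (fun t => t ≤ b ∧ b ≤ q + t),
        (∑ D ∈ diagrams p, ∑ K ∈ diagrams (q + t - b),
          kostka d s D * if IsHorizontalStrip K E ∧ IsHorizontalStrip K D then 1 else 0) =
        ∑ i ∈ boundedCompositions s (a - t) d, kostka (d - Function.update i s t) (s + 1) E := by
      intro t ht
      simp only [Finset.mem_filter, Finset.mem_range] at ht
      have hsize : q + t - b + (a - t) = p := by omega
      rw [Finset.sum_comm]
      have h4 : ∀ K ∈ diagrams (q + t - b),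
          (∑ D ∈ diagrams p,
            kostka d s D * if IsHorizontalStrip K E ∧ IsHorizontalStrip K D then 1 else 0) =
          if IsHorizontalStrip K E then ∑ i ∈ boundedCompositions s (a - t) d, kostka (d - i) s K
          else 0 := fun K hK => by
        rw [← ih (q + t - b) (a - t) hsize K (mem_diagrams.1 hK), hsize]
        by_cases hKE : IsHorizontalStrip K E
        · simp only [hKE, true_and, if_true]
          exact Finset.sum_congr rfl fun D _ => by simp
        · simp [hKE]
      rw [Finset.sum_congr rfl h4, ← Finset.sum_filter, Finset.sum_comm]
      refine Finset.sum_congr rfl fun i hi => ?_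
      have h5 : ∀ j < s, (d - Function.update i s t) j = (d - i) j := fun j hj => by
        rw [Pi.sub_apply, Pi.sub_apply, Function.update_of_ne (by omega)]
      have h6 := partialSum_sub hi
      rw [kostka_succ, partialSum_congr h5, Finset.sum_filter,
        show partialSum (d - i) s = q + t - b by omega]
      exact Finset.sum_congr rfl fun K _ => by rw [kostka_congr h5]
    rw [Finset.sum_congr rfl h3]
    refine Finset.sum_subset (fun t ht => ?_) fun t ht ht' => ?_
    · simp only [Finset.mem_filter, Finset.mem_range] at ht ⊢
      exact ⟨ht.1, ht.2.1⟩
    · refine Finset.sum_eq_zero fun i hi => ?_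
      have := partialSum_sub hi
      simp only [Finset.mem_filter, Finset.mem_range] at ht ht'
      omega

end Kostka

/-! ### Counting matrices by their last row -/

section Counting

open Function in
/-- Splitting off the last row of a matrix. -/
def contingencyMatricesSuccEquiv (c : ℕ → ℕ) (r : ℕ) (d : ℕ → ℕ) (s : ℕ) :
    contingencyMatrices c (r + 1) d s ≃
      Σ i : boundedCompositions s (c r) d, contingencyMatrices c r (d - i.1) s where
  toFun m := ⟨⟨m.1 r, mem_boundedCompositions.2 ⟨m.2.1 r (Nat.lt_succ_self r),
      fun j hj => m.2.2.2 r j (Or.inr hj), fun j => by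
        rcases lt_or_ge j s with hj | hj
        · rw [← m.2.2.1 j hj]
          exact Finset.single_le_sum (f := fun i => m.1 i j) (fun _ _ => Nat.zero_le _)
            (Finset.mem_range.2 (Nat.lt_succ_self r))
        · rw [m.2.2.2 r j (Or.inr hj)]
          exact Nat.zero_le _⟩⟩, ⟨update m.1 r 0, by
    refine ⟨fun i hi => ?_, fun j hj => ?_, fun i j hij => ?_⟩
    · rw [update_of_ne (by omega)]
      exact m.2.1 i (by omega)
    · have h1 := m.2.2.1 j hj
      rw [Finset.sum_range_succ] at h1
      rw [Finset.sum_congr rfl fun i hi => by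
        rw [update_of_ne (by have := Finset.mem_range.1 hi; omega)]]
      simp only [Pi.sub_apply]
      omega
    · rcases eq_or_ne i r with rfl | hne
      · rw [update_self]; rfl
      · rw [update_of_ne hne]
        exact m.2.2.2 i j (by omega)⟩⟩
  invFun x := ⟨update x.2.1 r x.1.1, by
    obtain ⟨⟨i, hi⟩, m, hm⟩ := x
    obtain ⟨h1, h2, h3⟩ := mem_boundedCompositions.1 hi
    refine ⟨fun k hk => ?_, fun j hj => ?_, fun k j hkj => ?_⟩
    · rcases eq_or_ne k r with rfl | hne
      · simp only [update_self]
        exact h1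
      · simp only [update_of_ne hne]
        exact hm.1 k (by omega)
    · have h4 := hm.2.1 j hj
      have h5 := h3 j
      rw [Finset.sum_range_succ, Finset.sum_congr rfl fun k hk => by
        rw [update_of_ne (by have := Finset.mem_range.1 hk; omega)]]
      simp only [Pi.sub_apply, update_self] at h4 ⊢
      omega
    · rcases eq_or_ne k r with rfl | hne
      · simp only [update_self]
        exact h2 j (by omega)
      · simp only [update_of_ne hne]
        exact hm.2.2 k j (by omega)⟩
  left_inv m := by
    apply Subtype.ext
    simp
  right_inv x := by
    obtain ⟨⟨i, hi⟩, m, hm⟩ := x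
    have h0 : m r = 0 := funext fun j => hm.2.2 r j (Or.inl le_rfl)
    refine Sigma.subtype_ext (Subtype.ext (update_self _ _ _)) ?_
    change update (update m r i) r 0 = m
    rw [update_idem, ← h0, update_eq_self]

lemma finite_contingencyMatrices (c : ℕ → ℕ) (r : ℕ) (d : ℕ → ℕ) (s : ℕ) :
    Finite (contingencyMatrices c r d s) := by
  induction r generalizing d with
  | zero =>
    have : Subsingleton (contingencyMatrices c 0 d s) := ⟨fun m m' => Subtype.ext <|
      funext fun i => funext fun j => by
        rw [m.2.2.2 i j (Or.inl (Nat.zero_le i)), m'.2.2.2 i j (Or.inl (Nat.zero_le i))]⟩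
    infer_instance
  | succ r ih =>
    have := fun i : boundedCompositions s (c r) d => ih (d - i.1)
    exact Finite.of_equiv _ (contingencyMatricesSuccEquiv c r d s).symm

lemma ncard_contingencyMatrices_succ (c : ℕ → ℕ) (r : ℕ) (d : ℕ → ℕ) (s : ℕ) :
    (contingencyMatrices c (r + 1) d s).ncard =
      ∑ i ∈ boundedCompositions s (c r) d, (contingencyMatrices c r (d - i) s).ncard := by
  have := fun i : boundedCompositions s (c r) d =>
    finite_contingencyMatrices c r (d - i.1) s
  rw [← Nat.card_coe_set_eq, Nat.card_congr (contingencyMatricesSuccEquiv c r d s),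
    Nat.card_sigma]
  exact Finset.sum_coe_sort (boundedCompositions s (c r) d)
    fun i => (contingencyMatrices c r (d - i) s).ncard

/-- The matrices with given row and column sums are counted by pairs of chains of horizontal
strips, as in the Robinson–Schensted–Knuth correspondence. -/
lemma sum_kostka_mul_kostka {c d : ℕ → ℕ} {r s n : ℕ} (hr : partialSum c r = n)
    (hs : partialSum d s = n) :
    ∑ D ∈ diagrams n, kostka c r D * kostka d s D = (contingencyMatrices c r d s).ncard := by
  classical
  induction r generalizing d n with
  | zero =>
    obtain rfl : n = 0 := hr.symm
    have hd0 : ∀ j < s, d j = 0 := fun j hj =>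
      (Finset.sum_eq_zero_iff_of_nonneg fun _ _ => Nat.zero_le _).1 hs j (Finset.mem_range.2 hj)
    have hM : contingencyMatrices c 0 d s = {0} := by
      ext m
      constructor
      · exact fun hm => funext fun i => funext fun j => hm.2.2 i j (Or.inl (Nat.zero_le i))
      · rintro rfl
        exact ⟨fun i hi => absurd hi (Nat.not_lt_zero i), fun j hj => by simp [hd0 j hj],
          fun _ _ _ => rfl⟩
    rw [hM, Set.ncard_singleton, diagrams_zero, Finset.sum_singleton, kostka_bot hs,
      kostka_zero, if_pos rfl]
  | succ r ih =>
    rw [partialSum_succ] at hr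
    subst hr
    rw [ncard_contingencyMatrices_succ c r d s]
    have h1 : ∀ D, kostka c (r + 1) D * kostka d s D = ∑ N ∈ diagrams (partialSum c r),
        if IsHorizontalStrip N D then kostka c r N * kostka d s D else 0 := fun D => by
      rw [kostka_succ, Finset.sum_mul]
      exact Finset.sum_congr rfl fun N _ => by rw [ite_mul, zero_mul]
    simp only [h1]
    rw [Finset.sum_comm]
    have h2 : ∀ N ∈ diagrams (partialSum c r),
        (∑ D ∈ diagrams (partialSum c r + c r),
          if IsHorizontalStrip N D then kostka c r N * kostka d s D else 0) =
        ∑ i ∈ boundedCompositions s (c r) d, kostka c r N * kostka (d - i) s N := fun N hN => by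
      rw [← Finset.mul_sum,
        ← sum_kostka_superdiagrams s d (partialSum c r) (c r) hs.symm N (mem_diagrams.1 hN),
        Finset.mul_sum]
      exact Finset.sum_congr rfl fun D _ => by rw [mul_ite, mul_zero]
    rw [Finset.sum_congr rfl h2, Finset.sum_comm]
    refine Finset.sum_congr rfl fun i hi => ih rfl ?_
    have := partialSum_sub hi
    omega

end Counting

/-! ### Unitriangularity of the Kostka numbers -/

section Triangularity

lemma exists_of_kostka_succ_ne_zero {c : ℕ → ℕ} {r : ℕ} {D : YoungDiagram}
    (h : kostka c (r + 1) D ≠ 0) :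
    ∃ N : YoungDiagram, N.card = partialSum c r ∧ IsHorizontalStrip N D ∧ kostka c r N ≠ 0 := by
  classical
  rw [kostka_succ] at h
  obtain ⟨N, hN, hne⟩ := Finset.exists_ne_zero_of_sum_ne_zero h
  by_cases hs : IsHorizontalStrip N D
  · rw [if_pos hs] at hne
    exact ⟨N, mem_diagrams.1 hN, hs, hne⟩
  · exact absurd (if_neg hs) hne

lemma rowLen_eq_zero_of_kostka_ne_zero {c : ℕ → ℕ} {r : ℕ} {D : YoungDiagram}
    (h : kostka c r D ≠ 0) {i : ℕ} (hi : r ≤ i) : D.rowLen i = 0 := by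
  classical
  induction r generalizing D i with
  | zero =>
    obtain rfl : D = ⊥ := by
      by_contra hne
      exact h (by rw [kostka_zero, if_neg hne])
    exact rowLen_eq_zero_of_card_le (Nat.zero_le i)
  | succ r ih =>
    obtain ⟨N, -, hs, hN⟩ := exists_of_kostka_succ_ne_zero h
    obtain ⟨j, rfl⟩ : ∃ j, i = j + 1 := ⟨i - 1, by omega⟩
    have h1 := (isHorizontalStrip_iff.1 hs j).2
    have h2 := ih hN (i := j) (by omega)
    omega

/-- The first `i` strips of a chain lie in the first `i` rows. -/
lemma partialSum_le_of_kostka_ne_zero {c : ℕ → ℕ} {r : ℕ} {D : YoungDiagram}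
    (hD : D.card = partialSum c r) (h : kostka c r D ≠ 0) {i : ℕ} (hi : i ≤ r) :
    partialSum c i ≤ partialSum D.rowLen i := by
  induction r generalizing D i with
  | zero =>
    obtain rfl : i = 0 := by omega
    exact le_rfl
  | succ r ih =>
    rcases hi.eq_or_lt with rfl | hlt
    · rw [← card_eq_partialSum fun j hj => rowLen_eq_zero_of_kostka_ne_zero h hj, hD]
    · obtain ⟨N, hNc, hs, hN⟩ := exists_of_kostka_succ_ne_zero h
      exact (ih hNc hN (i := i) (by omega)).trans
        (Finset.sum_le_sum fun j _ => (isHorizontalStrip_iff.1 hs j).1)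

lemma kostka_eq_one {c : ℕ → ℕ} {r : ℕ} {D : YoungDiagram} (h : ∀ i < r, D.rowLen i = c i)
    (h0 : ∀ i, r ≤ i → D.rowLen i = 0) : kostka c r D = 1 := by
  classical
  induction r generalizing D with
  | zero =>
    have : D = ⊥ := eq_of_rowLen_eq fun i => by
      rw [h0 i (Nat.zero_le i), rowLen_eq_zero_of_card_le (Nat.zero_le i)]
    rw [kostka_zero, if_pos this]
  | succ r ih =>
    -- The only diagram with `r` rows that differs from `D` by a strip of size `c r` consists of the
    -- first `r` rows of `D`.
    let N₀ := diagramOfRows (fun i => if i < r then D.rowLen i else 0) r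
    have hN₀ : ∀ i, N₀.rowLen i = if i < r then D.rowLen i else 0 := by
      refine fun i => rowLen_diagramOfRows (fun i => ?_) (fun i hi => if_neg (by omega)) i
      have := D.rowLen_anti i (i + 1) (Nat.le_succ i)
      split_ifs <;> omega
    have hz : ∀ i, r ≤ i → N₀.rowLen i = 0 := fun i hi => by rw [hN₀, if_neg (by omega)]
    have hrow : ∀ i < r, N₀.rowLen i = c i := fun i hi => by rw [hN₀, if_pos hi, h i (by omega)]
    have hcard : N₀.card = partialSum c r := by
      rw [card_eq_partialSum hz]
      exact partialSum_congr hrow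
    have hstrip : IsHorizontalStrip N₀ D := isHorizontalStrip_iff.2 fun i => by
      have h1 := D.rowLen_anti i (i + 1) (Nat.le_succ i)
      rw [hN₀]
      split_ifs with hi
      · exact ⟨le_rfl, h1⟩
      · exact ⟨Nat.zero_le _, (h0 (i + 1) (by omega)).le⟩
    rw [kostka_succ, Finset.sum_eq_single N₀, if_pos hstrip, ih hrow hz]
    · intro N hN hne
      by_contra hcon
      have hs : IsHorizontalStrip N D := by
        by_contra hs
        exact hcon (if_neg hs)
      rw [if_pos hs] at hcon
      have hNz := fun i (hi : r ≤ i) => rowLen_eq_zero_of_kostka_ne_zero hcon hi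
      have hle : ∀ i ∈ Finset.range r, N.rowLen i ≤ c i := fun i hi => by
        have hi' := Finset.mem_range.1 hi
        rw [← h i (by omega)]
        exact (isHorizontalStrip_iff.1 hs i).1
      have hsum : ∑ i ∈ Finset.range r, N.rowLen i = ∑ i ∈ Finset.range r, c i :=
        (card_eq_partialSum hNz).symm.trans (mem_diagrams.1 hN)
      have heq := (Finset.sum_eq_sum_iff_of_le hle).1 hsum
      refine hne (eq_of_rowLen_eq fun i => ?_)
      rcases lt_or_ge i r with hi | hi
      · rw [heq i (Finset.mem_range.2 hi), hrow i hi]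
      · rw [hNz i hi, hz i hi]
    · exact fun hN => absurd (mem_diagrams.2 hcard) hN

variable {n : ℕ}

lemma Diagram.rowLen_eq_zero (D : Diagram n) {i : ℕ} (hi : n ≤ i) : D.1.rowLen i = 0 :=
  rowLen_eq_zero_of_card_le (by rw [D.2]; exact hi)

lemma Diagram.partialSum_rowLen (D : Diagram n) {i : ℕ} (hi : n ≤ i) :
    partialSum D.1.rowLen i = n := by
  rw [← card_eq_partialSum fun j hj => D.rowLen_eq_zero (hi.trans hj), D.2]

lemma kostka_rowLen_self (D : Diagram n) : kostka D.1.rowLen n D.1 = 1 :=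
  kostka_eq_one (fun _ _ => rfl) fun _ hi => D.rowLen_eq_zero hi

lemma eq_or_strictlyDominates_of_kostka_ne_zero {D E : Diagram n}
    (h : kostka D.1.rowLen n E.1 ≠ 0) : E = D ∨ StrictlyDominates E D := by
  rcases eq_or_ne E D with heq | hne
  · exact Or.inl heq
  · refine Or.inr ⟨hne.symm, fun i => ?_⟩
    change partialSum D.1.rowLen i ≤ partialSum E.1.rowLen i
    rcases le_total i n with hi | hi
    · exact partialSum_le_of_kostka_ne_zero
        (by rw [E.2, D.partialSum_rowLen le_rfl]) h hi
    · rw [D.partialSum_rowLen hi, E.partialSum_rowLen hi]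

lemma eq_of_partialSum_rowLen_eq {D E : YoungDiagram}
    (h : ∀ i, partialSum D.rowLen i = partialSum E.rowLen i) : D = E :=
  eq_of_rowLen_eq fun i => by
    have h1 := h (i + 1)
    rw [partialSum_succ, partialSum_succ, h i] at h1
    omega

lemma wellFounded_strictlyDominates :
    WellFounded (StrictlyDominates : Diagram n → Diagram n → Prop) := by
  have : IsTrans (Diagram n) StrictlyDominates := ⟨fun A B C hAB hBC => by
    refine ⟨?_, fun i => (hBC.2 i).trans (hAB.2 i)⟩
    rintro rfl
    exact hBC.1 (Subtype.ext (eq_of_partialSum_rowLen_eq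
      fun i => le_antisymm (hBC.2 i) (hAB.2 i)))⟩
  have : Std.Irrefl (StrictlyDominates : Diagram n → Diagram n → Prop) := ⟨fun A h => h.1 rfl⟩
  exact Finite.wellFounded_of_trans_of_irrefl _

open Classical in
/-- Inversion of the unitriangular matrix of Kostka numbers, by induction on the dominance order. -/
lemma exists_inverse_kostka (E : Diagram n) :
    ∃ a : Diagram n → ℤ, ∀ X : Diagram n,
      ∑ D, a D * (kostka D.1.rowLen n X.1 : ℤ) = if X = E then 1 else 0 := by
  induction E using wellFounded_strictlyDominates.induction with
  | _ E ih =>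
    choose! a ha using ih
    refine ⟨fun D => (if D = E then 1 else 0) -
      ∑ E' ∈ Finset.univ.filter fun E' => StrictlyDominates E' E,
        (kostka E.1.rowLen n E'.1 : ℤ) * a E' D, fun X => ?_⟩
    simp only [sub_mul, Finset.sum_sub_distrib, ite_mul, one_mul, zero_mul, Finset.sum_ite_eq',
      Finset.mem_univ, if_true, Finset.sum_mul, mul_assoc]
    rw [Finset.sum_comm]
    have h1 : ∀ E' ∈ Finset.univ.filter (fun E' => StrictlyDominates E' E),
        ∑ D, (kostka E.1.rowLen n E'.1 : ℤ) * (a E' D * (kostka D.1.rowLen n X.1 : ℤ)) =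
          if X = E' then (kostka E.1.rowLen n E'.1 : ℤ) else 0 := fun E' hE' => by
      rw [← Finset.mul_sum, ha E' (Finset.mem_filter.1 hE').2, mul_ite, mul_one, mul_zero]
    rw [Finset.sum_congr rfl h1, Finset.sum_ite_eq]
    simp only [Finset.mem_filter, Finset.mem_univ, true_and]
    by_cases hX : X = E
    · subst hX
      rw [if_neg fun h => h.1 rfl, if_pos rfl, kostka_rowLen_self]
      simp
    · rw [if_neg hX]
      split_ifs with hs
      · exact sub_self _
      · rw [sub_zero, Nat.cast_eq_zero]
        by_contra hne
        rcases eq_or_strictlyDominates_of_kostka_ne_zero hne with h | h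
        · exact hX h
        · exact hs h

/-- The entries of the inverse of the matrix of Kostka numbers of diagrams with `n` boxes. -/
def inverseKostka (E D : Diagram n) : ℤ := (exists_inverse_kostka E).choose D

lemma sum_inverseKostka_mul_kostka [DecidableEq (Diagram n)] (E X : Diagram n) :
    ∑ D, inverseKostka E D * (kostka D.1.rowLen n X.1 : ℤ) = if X = E then 1 else 0 := by
  refine ((exists_inverse_kostka E).choose_spec X).trans ?_
  congr

end Triangularity

/-! ### The spherical principal series -/

section SphericalPrincipalSeries

open Representation

variable (F : Type*) [Field F] [Finite F]

/-- The permutation character of `GLₙ(F)` on the flags with block sizes `c`. -/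
def flagCharacter (n : ℕ) (c : ℕ → ℕ) : GL (Fin n) F → ℂ :=
  (functionRep (GL (Fin n) F) (GL (Fin n) F ⧸ compositionParabolic F n c)).character

/-- The virtual character `∑ a_D I_D` with the coefficients `a_D` of the inverse Kostka matrix. It
is the character of `ρ_E` by `sps_spec`. -/
def sphericalCharacter {n : ℕ} (E : Diagram n) : GL (Fin n) F → ℂ :=
  ∑ D, inverseKostka E D • flagCharacter F n D.1.rowLen

variable {F}

lemma pairing_flagCharacter {n : ℕ} {c d : ℕ → ℕ} {r s : ℕ} (hc : ∀ l, r ≤ l → c l = 0)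
    (hd : ∀ l, s ≤ l → d l = 0) (hr : partialSum c r = n) (hs : partialSum d s = n) :
    pairing (flagCharacter F n c) (flagCharacter F n d) =
      ∑ X : Diagram n, (kostka c r X.1 : ℂ) * kostka d s X.1 := by
  rw [flagCharacter, flagCharacter, pairing_functionRep_functionRep,
    card_orbits_eq_ncard hc hd hr hs, ← sum_kostka_mul_kostka hr hs, sum_diagrams]
  push_cast
  rfl

variable {n : ℕ}

lemma flagCharacter_mem (c : ℕ → ℕ) : flagCharacter F n c ∈ hermitianFunctions (GL (Fin n) F) :=
  character_mem_hermitianFunctions _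

lemma sphericalCharacter_mem (E : Diagram n) :
    sphericalCharacter F E ∈ hermitianFunctions (GL (Fin n) F) :=
  sum_mem fun _ _ => zsmul_mem (flagCharacter_mem _) _

lemma pairing_sphericalCharacter_flagCharacter (E : Diagram n) {c : ℕ → ℕ} {r : ℕ}
    (hc : ∀ l, r ≤ l → c l = 0) (hr : partialSum c r = n) :
    pairing (sphericalCharacter F E) (flagCharacter F n c) = kostka c r E.1 := by
  classical
  rw [sphericalCharacter, pairing_sum_left]
  have h1 : ∀ D : Diagram n,
      pairing (inverseKostka E D • flagCharacter F n D.1.rowLen) (flagCharacter F n c) =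
      ∑ X : Diagram n, ((inverseKostka E D * (kostka D.1.rowLen n X.1 : ℤ) : ℤ) : ℂ) *
        kostka c r X.1 := fun D => by
    rw [pairing_zsmul_left, pairing_flagCharacter (fun l hl => D.rowLen_eq_zero hl) hc
      (D.partialSum_rowLen le_rfl) hr, Finset.mul_sum]
    exact Finset.sum_congr rfl fun X _ => by push_cast; ring
  rw [Finset.sum_congr rfl fun D _ => h1 D, Finset.sum_comm]
  simp only [← Finset.sum_mul, ← Int.cast_sum, sum_inverseKostka_mul_kostka]
  simp

lemma pairing_sphericalCharacter [DecidableEq (Diagram n)] (E E' : Diagram n) :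
    pairing (sphericalCharacter F E) (sphericalCharacter F E') = if E = E' then 1 else 0 := by
  conv_lhs => rw [sphericalCharacter.eq_def F E', pairing_sum_right]
  have h1 : ∀ D : Diagram n,
      pairing (sphericalCharacter F E) (inverseKostka E' D • flagCharacter F n D.1.rowLen) =
      ((inverseKostka E' D * (kostka D.1.rowLen n E.1 : ℤ) : ℤ) : ℂ) := fun D => by
    rw [pairing_zsmul_right, pairing_sphericalCharacter_flagCharacter E
      (fun l hl => D.rowLen_eq_zero hl) (D.partialSum_rowLen le_rfl)]
    push_cast
    rfl
  rw [Finset.sum_congr rfl fun D _ => h1 D, ← Int.cast_sum, sum_inverseKostka_mul_kostka]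
  push_cast
  rfl

/-- Young's rule for `GLₙ(F)`. -/
lemma flagCharacter_eq_sum {c : ℕ → ℕ} {r : ℕ} (hc : ∀ l, r ≤ l → c l = 0)
    (hr : partialSum c r = n) :
    flagCharacter F n c = ∑ X : Diagram n, (kostka c r X.1 : ℤ) • sphericalCharacter F X := by
  classical
  set Y := ∑ X : Diagram n, (kostka c r X.1 : ℤ) • sphericalCharacter F X with hY
  have h1 : ∀ X, pairing (sphericalCharacter F X) Y = kostka c r X.1 := fun X => by
    rw [hY, pairing_sum_right]
    simp only [pairing_zsmul_right, pairing_sphericalCharacter]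
    simp
  have h2 : ∀ X, pairing (sphericalCharacter F X) (flagCharacter F n c - Y) = 0 := fun X => by
    rw [pairing_sub_right, h1, pairing_sphericalCharacter_flagCharacter X hc hr, sub_self]
  have h3 : pairing Y (flagCharacter F n c - Y) = 0 := by
    rw [hY, pairing_sum_left, ← hY]
    exact Finset.sum_eq_zero fun X _ => by rw [pairing_zsmul_left, h2, mul_zero]
  have h4 : pairing Y (flagCharacter F n c) = pairing Y Y := by
    rw [pairing_sub_right] at h3
    exact sub_eq_zero.1 h3
  have h5 : pairing Y Y = ∑ X : Diagram n, (kostka c r X.1 : ℂ) * kostka c r X.1 := by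
    conv_lhs => rw [hY, pairing_sum_left, ← hY]
    exact Finset.sum_congr rfl fun X _ => by rw [pairing_zsmul_left, h1]; push_cast; rfl
  -- The difference of the two sides has norm zero.
  refine eq_of_pairing (flagCharacter_mem c)
    (sum_mem fun X _ => zsmul_mem (sphericalCharacter_mem X) _) ?_
  rw [pairing_sub_left, h3, sub_zero, pairing_sub_right, pairing_comm _ Y, h4, h5,
    pairing_flagCharacter hc hc hr hr, sub_self]

omit [Finite F] in
lemma flagRep_character (D : Diagram n) :
    (flagRep F D).character = flagCharacter F n D.1.rowLen := rfl

lemma finrank_eq_kostka {V : Type*} [AddCommGroup V] [Module ℂ V] [FiniteDimensional ℂ V]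
    {ρ : Representation ℂ (GL (Fin n) F) V} {E : Diagram n}
    (hρ : ρ.character = sphericalCharacter F E) (D : Diagram n) :
    Module.finrank ℂ (ρ.IntertwiningMap (flagRep F D)) = kostka D.1.rowLen n E.1 := by
  have h := pairing_character ρ (flagRep F D)
  rw [hρ, pairing_comm, flagRep_character, pairing_sphericalCharacter_flagCharacter E
    (fun l hl => D.rowLen_eq_zero hl) (D.partialSum_rowLen le_rfl)] at h
  exact_mod_cast h.symm

lemma exists_sub_character_eq (E : Diagram n) :
    ∃ U : Subrepresentation (flagRep F E), U.toRepresentation.IsIrreducible ∧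
      U.toRepresentation.character = sphericalCharacter F E := by
  classical
  refine exists_irreducible_character_eq (sphericalCharacter_mem E)
    (by rw [pairing_sphericalCharacter, if_pos rfl]) (fun U => ?_) (z := 1) one_pos ?_
  · refine ⟨∑ D, inverseKostka E D *
      (Module.finrank ℂ (U.toRepresentation.IntertwiningMap (flagRep F D)) : ℤ), ?_⟩
    rw [sphericalCharacter, pairing_sum_left]
    push_cast
    refine Finset.sum_congr rfl fun D _ => ?_
    rw [pairing_zsmul_left, ← flagRep_character, pairing_character]
  · rw [flagRep_character, pairing_sphericalCharacter_flagCharacter E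
      (fun l hl => E.rowLen_eq_zero hl) (E.partialSum_rowLen le_rfl), kostka_rowLen_self]
    simp

lemma isNewIn_of_character_eq {E : Diagram n} {U : Subrepresentation (flagRep F E)}
    (hU : U.toRepresentation.IsIrreducible)
    (hχ : U.toRepresentation.character = sphericalCharacter F E) : IsNewIn F E U := by
  refine ⟨hU, fun D hD hocc => ?_⟩
  have h1 := (occursIn_iff_finrank_pos hU).1 hocc
  rw [finrank_eq_kostka hχ] at h1
  rcases eq_or_strictlyDominates_of_kostka_ne_zero h1.ne' with h | h
  · exact hD.1 h
  · exact hD.1 (Subtype.ext (eq_of_partialSum_rowLen_eq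
      fun i => le_antisymm (hD.2 i) (h.2 i)))

/-- By Young's rule, all constituents of `I_E` except `ρ_E`, which has multiplicity one, occur in
some `I_D` with `D` strictly dominating `E`. -/
lemma IsNewIn.eq {E : Diagram n} {U U' : Subrepresentation (flagRep F E)}
    (hU : U.toRepresentation.IsIrreducible)
    (hχ : U.toRepresentation.character = sphericalCharacter F E) (hU' : IsNewIn F E U') :
    U' = U := by
  classical
  obtain ⟨hirr, hnew⟩ := hU'
  have h1 := (occursIn_iff_finrank_pos hirr).1 (occursIn_inclusion U')
  have h2 := pairing_character U'.toRepresentation (flagRep F E)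
  rw [flagRep_character, flagCharacter_eq_sum (fun l hl => E.rowLen_eq_zero hl)
    (E.partialSum_rowLen le_rfl), pairing_sum_left] at h2
  obtain ⟨X, hX⟩ : ∃ X : Diagram n, pairing ((kostka E.1.rowLen n X.1 : ℤ) •
      sphericalCharacter F X) U'.toRepresentation.character ≠ 0 := by
    by_contra hall
    push Not at hall
    rw [Finset.sum_eq_zero fun X _ => hall X] at h2
    have : Module.finrank ℂ (U'.toRepresentation.IntertwiningMap (flagRep F E)) = 0 := by
      exact_mod_cast h2.symm
    omega
  rw [pairing_zsmul_left] at hX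
  obtain ⟨UX, hUX, hχX⟩ := exists_sub_character_eq (F := F) X
  have hpair : pairing UX.toRepresentation.character U'.toRepresentation.character ≠ 0 := by
    rw [hχX]
    exact right_ne_zero_of_mul hX
  obtain ⟨e⟩ := nonempty_equiv_of_pairing_ne_zero hirr hUX hpair
  have hk : kostka E.1.rowLen n X.1 ≠ 0 := by
    have := left_ne_zero_of_mul hX
    exact_mod_cast this
  rcases eq_or_strictlyDominates_of_kostka_ne_zero hk with rfl | hdom
  -- Here `U` and `U'` are isomorphic, hence equal, as `U` occurs only once in `I_E`.
  · have hcomp : pairing U.toRepresentation.character U'.toRepresentation.character ≠ 0 := by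
      rw [char_iso e, hχ, hχX, pairing_sphericalCharacter, if_pos rfl]
      exact one_ne_zero
    obtain ⟨e'⟩ := nonempty_equiv_of_pairing_ne_zero hirr hU hcomp
    have hone : Module.finrank ℂ (U.toRepresentation.IntertwiningMap (flagRep F X)) = 1 := by
      rw [finrank_eq_kostka hχ, kostka_rowLen_self]
    have hne : inclusionMap U ≠ 0 := fun h0 => by
      obtain ⟨a, b, hab⟩ := hU.toNontrivial
      refine hab (Subrepresentation.toSubmodule_injective ?_)
      ext v
      have hv : v = 0 := inclusionMap_injective U (by rw [h0]; simp)
      rw [hv]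
      simp
    obtain ⟨z, hz⟩ := (finrank_eq_one_iff_of_nonzero' _ hne).1 hone
      ((inclusionMap U').comp e'.symm.toIntertwiningMap)
    apply Subrepresentation.toSubmodule_injective
    refine Submodule.eq_of_le_of_finrank_eq (fun x hx => ?_) e'.toLinearEquiv.finrank_eq
    have hzx := DFunLike.congr_fun hz (e' ⟨x, hx⟩)
    have hx1 : ((inclusionMap U').comp e'.symm.toIntertwiningMap) (e' ⟨x, hx⟩) = x := by
      change ((e'.symm (e' ⟨x, hx⟩) : U'.toSubmodule) : _) = x
      rw [Representation.Equiv.symm_apply_apply]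
    rw [hx1] at hzx
    rw [← hzx]
    exact U.toSubmodule.smul_mem z (e' ⟨x, hx⟩).2
  · refine absurd ⟨(inclusionMap UX).comp e.toIntertwiningMap, ?_⟩ (hnew X hdom)
    exact (inclusionMap_injective UX).comp e.toLinearEquiv.injective

/-- The representation `ρ_E` is irreducible with character `sphericalCharacter F E`: the sum that
defines it has exactly one summand. -/
lemma sps_spec (E : Diagram n) :
    (sps F E).IsIrreducible ∧ (sps F E).character = sphericalCharacter F E := by
  obtain ⟨U, hU, hχ⟩ := exists_sub_character_eq (F := F) E
  have h : spsSub F E = U := by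
    apply Subrepresentation.toSubmodule_injective
    refine le_antisymm (iSup_le fun U' => ?_) ?_
    · exact (congrArg Subrepresentation.toSubmodule (IsNewIn.eq hU hχ U'.2)).le
    · exact le_iSup (fun U : {U : Subrepresentation (flagRep F E) // IsNewIn F E U} =>
        U.1.toSubmodule) ⟨U, isNewIn_of_character_eq hU hχ⟩
  rw [sps, h]
  exact ⟨hU, hχ⟩

end SphericalPrincipalSeries

/-! ### The Pieri rule -/

section Pieri

open Representation

variable {F : Type*} [Field F]

lemma mem_stabilizer_coordSubspace_iff {n s : ℕ} {g : GL (Fin n) F} :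
    g ∈ stabilizer F (coordSubspace F n s) ↔
      ∀ i j : Fin n, (j : ℕ) < s → s ≤ (i : ℕ) → (g : Matrix (Fin n) (Fin n) F) i j = 0 := by
  rw [mem_stabilizer_iff]
  constructor
  · intro h i j hj hi
    have h1 := h (Pi.single j 1 : Fin n → F)
      (fun l hl => Pi.single_eq_of_ne (by rintro rfl; omega) _) i hi
    simpa using h1
  · intro h v hv i hi
    change ∑ j, (g : Matrix (Fin n) (Fin n) F) i j * v j = 0
    refine Finset.sum_eq_zero fun j _ => ?_
    rcases lt_or_ge (j : ℕ) s with hj | hj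
    · rw [h i j hj hi, zero_mul]
    · rw [hv j hj, mul_zero]

/-- The flag type of `D`, padded with zeros to length `k`, followed by a block of size `m`. -/
def appendBlock {k : ℕ} (D : Diagram k) (m : ℕ) : ℕ → ℕ := Function.update D.1.rowLen k m

lemma appendBlock_of_lt {k : ℕ} (D : Diagram k) (m : ℕ) {i : ℕ} (hi : i < k) :
    appendBlock D m i = D.1.rowLen i := Function.update_of_ne (by omega) _ _

lemma appendBlock_of_le {k : ℕ} (D : Diagram k) (m : ℕ) {i : ℕ} (hi : k + 1 ≤ i) :
    appendBlock D m i = 0 := by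
  rw [appendBlock, Function.update_of_ne (by omega), D.rowLen_eq_zero (by omega)]

lemma partialSum_appendBlock_of_le {k : ℕ} (D : Diagram k) (m : ℕ) {i : ℕ} (hi : i ≤ k) :
    partialSum (appendBlock D m) i = partialSum D.1.rowLen i :=
  partialSum_congr fun _ hj => appendBlock_of_lt D m (by omega)

lemma partialSum_appendBlock {k : ℕ} (D : Diagram k) (m : ℕ) :
    partialSum (appendBlock D m) (k + 1) = k + m := by
  rw [partialSum_succ, partialSum_appendBlock_of_le D m le_rfl, D.partialSum_rowLen le_rfl,
    appendBlock, Function.update_self]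

/-- The parabolic subgroup of `GL_{k+m}` with one more block of size `m` is the preimage in
`P_{k,m}` of the parabolic subgroup of `GL_k`. -/
lemma compositionParabolic_appendBlock {k : ℕ} (D : Diagram k) (m : ℕ) :
    compositionParabolic F (k + m) (appendBlock D m) =
      ((compositionParabolic F k D.1.rowLen).comap (upperBlock k m)).map
        (maxParabolic F k m).subtype := by
  have hclaim : ∀ (p : maxParabolic F k m) (s : ℕ), s ≤ k →
      (upperBlock k m p ∈ stabilizer F (coordSubspace F k s) ↔
        p.1 ∈ stabilizer F (coordSubspace F (k + m) s)) := by
    intro p s hs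
    rw [mem_stabilizer_coordSubspace_iff, mem_stabilizer_coordSubspace_iff]
    constructor
    · intro h i j hj hi
      have hj' : j = Fin.castAdd m ⟨j, by omega⟩ := rfl
      rw [hj']
      refine Fin.addCases (fun i hi => ?_) (fun i _ => ?_) i hi
      · exact h i ⟨j, by omega⟩ hj hi
      · exact maxParabolic_lower_left p i _
    · exact fun h i j hj hi => h (Fin.castAdd m i) (Fin.castAdd m j) hj hi
  have htop : ∀ {n s : ℕ} (g : GL (Fin n) F), n ≤ s → g ∈ stabilizer F (coordSubspace F n s) :=
    fun {n s} g hs => mem_stabilizer_coordSubspace_iff.2 fun i j _ hi => by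
      have := i.2
      omega
  ext g
  constructor
  · intro hg
    have hg' := Subgroup.mem_iInf.1 hg
    have hmax : g ∈ maxParabolic F k m := by
      have := hg' k
      rwa [partialSum_appendBlock_of_le D m le_rfl, D.partialSum_rowLen le_rfl] at this
    refine ⟨⟨g, hmax⟩, Subgroup.mem_iInf.2 fun i => ?_, rfl⟩
    rcases le_total i k with hi | hi
    · have h1 : partialSum D.1.rowLen i ≤ k :=
        (partialSum_mono _ hi).trans (D.partialSum_rowLen le_rfl).le
      refine (hclaim ⟨g, hmax⟩ _ h1).2 ?_
      rw [← partialSum_appendBlock_of_le D m hi]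
      exact hg' i
    · exact htop _ (D.partialSum_rowLen hi).ge
  · rintro ⟨p, hp, rfl⟩
    refine Subgroup.mem_iInf.2 fun i => ?_
    rcases le_or_gt i k with hi | hi
    · have h1 : partialSum D.1.rowLen i ≤ k :=
        (partialSum_mono _ hi).trans (D.partialSum_rowLen le_rfl).le
      rw [partialSum_appendBlock_of_le D m hi]
      exact (hclaim p _ h1).1 (Subgroup.mem_iInf.1 hp i)
    · refine htop _ ?_
      rw [partialSum_of_le (fun l hl => appendBlock_of_le D m hl) hi, partialSum_appendBlock]

variable [Finite F]

open Classical in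
/-- The Kostka numbers, and hence the spherical characters, see the last block as a horizontal
strip. -/
lemma sum_inverseKostka_flagCharacter_appendBlock {k m : ℕ} (D : Diagram k) :
    ∑ E : Diagram k, inverseKostka D E • flagCharacter F (k + m) (appendBlock E m) =
      ∑ X : {X : Diagram (k + m) // IsHorizontalStrip D.1 X.1}, sphericalCharacter F X.1 := by
  have h1 : ∀ E : Diagram k, flagCharacter F (k + m) (appendBlock E m) =
      ∑ X : Diagram (k + m), (∑ N : Diagram k,
        if IsHorizontalStrip N.1 X.1 then (kostka E.1.rowLen k N.1 : ℤ) else 0) •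
          sphericalCharacter F X := fun E => by
    rw [flagCharacter_eq_sum (fun l hl => appendBlock_of_le E m hl) (partialSum_appendBlock E m)]
    refine Finset.sum_congr rfl fun X _ => ?_
    rw [kostka_succ, partialSum_appendBlock_of_le E m le_rfl, E.partialSum_rowLen le_rfl,
      sum_diagrams]
    push_cast
    congr 1
    refine Finset.sum_congr rfl fun N _ => ?_
    rw [kostka_congr fun i hi => appendBlock_of_lt E m hi]
  have h2 : ∀ X : Diagram (k + m), ∑ E : Diagram k, inverseKostka D E * (∑ N : Diagram k,
        if IsHorizontalStrip N.1 X.1 then (kostka E.1.rowLen k N.1 : ℤ) else 0) =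
      if IsHorizontalStrip D.1 X.1 then 1 else 0 := fun X => by
    simp only [Finset.mul_sum]
    rw [Finset.sum_comm]
    have h3 : ∀ N : Diagram k, (∑ E : Diagram k, inverseKostka D E *
        if IsHorizontalStrip N.1 X.1 then (kostka E.1.rowLen k N.1 : ℤ) else 0) =
        if N = D then (if IsHorizontalStrip D.1 X.1 then 1 else 0) else 0 := fun N => by
      by_cases hN : IsHorizontalStrip N.1 X.1
      · simp only [hN, if_true, sum_inverseKostka_mul_kostka]
        by_cases hND : N = D
        · subst hND
          simp [hN]
        · simp [hND]
      · by_cases hND : N = D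
        · subst hND
          simp [hN]
        · simp [hN, hND]
    simp only [h3, Finset.sum_ite_eq', Finset.mem_univ, if_true]
  simp only [h1, Finset.smul_sum, smul_smul]
  rw [Finset.sum_comm]
  simp only [← Finset.sum_smul, h2, ite_smul, one_smul, zero_smul]
  rw [← Finset.sum_filter]
  exact Finset.sum_subtype _ (by simp) _

lemma pairing_pieriRep_sub_eq_zero {k : ℕ} (m : ℕ) (D : Diagram k) {B : Type*} [AddCommGroup B]
    [Module ℂ B] [FiniteDimensional ℂ B] (σ : Representation ℂ (GL (Fin (k + m)) F) B) :
    pairing σ.character ((pieriRep F m D).character -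
      ∑ E : Diagram k, inverseKostka D E • flagCharacter F (k + m) (appendBlock E m)) = 0 := by
  rw [pairing_sub_right, sub_eq_zero]
  exact pairing_parabolicInd (inverseKostka D) (fun E => compositionParabolic F k E.1.rowLen)
    (fun E => compositionParabolic F (k + m) (appendBlock E m))
    (fun E => compositionParabolic_appendBlock E m) (sps F D) (sps_spec D).2 σ

/-- The induced character is the combination of the `I_E` with a block appended, because the
difference is orthogonal to both; by Young's rule this is a sum over horizontal strips. -/
lemma pieriRep_character {k : ℕ} (m : ℕ) (D : Diagram k)
    [Fintype {X : Diagram (k + m) // IsHorizontalStrip D.1 X.1}] :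
    (pieriRep F m D).character =
      ∑ X : {X : Diagram (k + m) // IsHorizontalStrip D.1 X.1}, (sps F X.1).character := by
  classical
  set Y := ∑ E : Diagram k, inverseKostka D E • flagCharacter F (k + m) (appendBlock E m) with hY
  have hsum : Y =
      ∑ X : {X : Diagram (k + m) // IsHorizontalStrip D.1 X.1}, (sps F X.1).character := by
    rw [hY, sum_inverseKostka_flagCharacter_appendBlock]
    refine Finset.sum_congr (by ext; simp) fun X _ => (sps_spec X.1).2.symm
  have hpair := pairing_pieriRep_sub_eq_zero (F := F) m D (pieriRep F m D)
  have hpair' : ∀ c, pairing (flagCharacter F (k + m) c) ((pieriRep F m D).character - Y) = 0 :=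
    fun c => pairing_pieriRep_sub_eq_zero m D (functionRep _ _)
  rw [← hY] at hpair
  rw [← hsum]
  refine eq_of_pairing (character_mem_hermitianFunctions _)
    (sum_mem fun E _ => zsmul_mem (flagCharacter_mem _) _) ?_
  rw [pairing_sub_left, hpair, hY, pairing_sum_left, ← hY, Finset.sum_eq_zero, sub_zero]
  exact fun E _ => by rw [pairing_zsmul_left, hpair', mul_zero]

end Pieri

end GLPieri

open GLPieri Representation

theorem mainTheorem1 (F : Type*) [Field F] [Finite F] (k m : ℕ) (D : GLPieri.Diagram k) :
    (GLPieri.sps F D).IsIrreducible ∧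
    (∀ E : GLPieri.Diagram (k + m), (GLPieri.sps F E).IsIrreducible) ∧
    GLPieri.IsMultiplicityFree (GLPieri.pieriRep F m D) ∧
    Nonempty ((GLPieri.pieriRep F m D).Equiv
      (Representation.directSum
        fun E : {E : GLPieri.Diagram (k + m) // GLPieri.IsHorizontalStrip D.1 E.1} =>
          GLPieri.sps F E.1)) ∧
    ∀ E : GLPieri.Diagram (k + m),
      GLPieri.OccursIn (GLPieri.sps F E) (GLPieri.pieriRep F m D) ↔
        GLPieri.IsHorizontalStrip D.1 E.1 := by
  classical
  have hirr : ∀ E : {E : Diagram (k + m) // IsHorizontalStrip D.1 E.1},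
      (sps F E.1).IsIrreducible := fun E => (sps_spec E.1).1
  have hpair : ∀ E E' : Diagram (k + m),
      pairing (sps F E).character (sps F E').character = if E = E' then 1 else 0 := fun E E' => by
    rw [(sps_spec E).2, (sps_spec E').2, pairing_sphericalCharacter]
  have horth : ∀ E E' : {E : Diagram (k + m) // IsHorizontalStrip D.1 E.1},
      pairing (sps F E.1).character (sps F E'.1).character = if E = E' then 1 else 0 :=
    fun E E' => by
      rw [hpair]
      exact if_congr Subtype.ext_iff.symm rfl rfl
  have hχ := pieriRep_character (F := F) m D
  refine ⟨(sps_spec D).1, fun E => (sps_spec E).1,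
    isMultiplicityFree_of_character_eq_sum hirr horth hχ,
    nonempty_equiv_directSum hirr horth hχ, fun E => ?_⟩
  rw [occursIn_iff_finrank_pos (sps_spec E).1]
  have h1 := pairing_character (sps F E) (pieriRep F m D)
  rw [hχ, pairing_sum_left] at h1
  simp only [hpair] at h1
  by_cases hE : IsHorizontalStrip D.1 E.1
  · refine iff_of_true ?_ hE
    rw [Finset.sum_eq_single ⟨E, hE⟩ (fun X _ hX => if_neg fun h => hX (Subtype.ext h))
      (fun h => absurd (Finset.mem_univ _) h), if_pos rfl] at h1
    have : Module.finrank ℂ ((sps F E).IntertwiningMap (pieriRep F m D)) = 1 := by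
      exact_mod_cast h1.symm
    omega
  · refine iff_of_false ?_ hE
    rw [Finset.sum_eq_zero fun X _ => if_neg fun h => hE (by rw [← h]; exact X.2)] at h1
    have : Module.finrank ℂ ((sps F E).IntertwiningMap (pieriRep F m D)) = 0 := by
      exact_mod_cast h1.symm
    omega
end
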